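/- Fix $T>0$. Let $\mathcal M([0,1])$ be the space of probability distributions on $[0,1]$ with the weak topology, and let $\mathscr W$ be the set of symmetric measurable functions $[0,1]^2\to[0,1]$ modulo a.e. equality, with the $L^1$ norm $\|\cdot\|_{L_1}$ and the cut distance $d_\square(h_1,h_2)=\sup_{S,S'\subseteq[0,1]\text{ measurable}}\big|\int_{S\times S'}(h_1-h_2)\,\mathrm dx\,\mathrm dy\big|$. For a (pseudo)metric space $E$ let $D(E,[0,T])$ be the space of càdlàg paths $[0,T]\to E$ with the Skorokhod ($J_1$) topology and its Borel $\sigma$-algebra. Let $H\colon[0,T]\times[0,1]^2\times D(\mathcal M([0,1]),[0,T])\to[0,1]$ be such that $H(t;u,v,F)$ is symmetric and Borel measurable in $(u,v)$. For $F\in D(\mathcal M([0,1]),[0,T])$ put $$g^{[F]}(t;x,y)=H\big(t;\bar F(t;x),\bar F(t;y),F\big),\qquad \bar F(t;u)=\inf\{x\in[0,1]: F(t;x)>u\}.$$ For every integer $n\ge1$ consider on some probability space a graph-valued process $(G_n(t))_{t\in[0,T]}$ on $n$ vertices, in which vertex $i$ carries at time $t$ a random type $X^{(n)}_i(t)\in[0,1]$.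 The empirical type distributions $F_n(t;x)=\frac1n\sum_{i=1}^n\mathbf 1\{X^{(n)}_i(t)\le x\}$ have paths in $D(\mathcal M([0,1]),[0,T])$. For every $t$, conditionally on all the types $(X^{(n)}_i(s))_{i\le n,\,s\in[0,T]}$, the edges present in $G_n(t)$ are independent and the edge $ij$ is active with probability $H(t;X^{(n)}_i(t),X^{(n)}_j(t),F_n)$; the joint law of the edges at different times is otherwise arbitrary. Let $E^{(n)}_{ij}(t)$ be the indicator that the edge between the vertices $i$ and $j$ is active at time $t$, and let $$C_n(t,\delta)=\sum_{1\le i<j\le n}\ \sup_{t\le u\le v\le (t+\delta)\wedge T}\big|E^{(n)}_{ij}(u)-E^{(n)}_{ij}(v)\big|.$$ At each time $t$ the vertices are given labels $1,\dots,n$. Let $h^{G_n}(t)=h^{G_n(t)}\in\mathscr W$ be the empirical graphon of the labelled graph: $h^{G_n(t)}(x,y)=1$ if the vertices with labels $\lceil nx\rceil$ and $\lceil ny\rceil$ are joined by an edge at time $t$, and $0$ otherwise. The process $h^{G_n}$ is assumed to be a random element of $D((\mathscr W,d_\square),[0,T])$. Assume that 1. the map $F\mapsto g^{[F]}$ is well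 defined and continuous from $D(\mathcal M([0,1]),[0,T])$ to $D((\mathscr W,\|\cdot\|_{L_1}),[0,T])$; 2. $F_n\Rightarrow F$ as $n\to\infty$ on $D(\mathcal M([0,1]),[0,T])$, for some random element $F$ of this space; 3. at any time $t\in[0,T]$ the labels are ordered by increasing type: the type of the vertex with label $k$ is at most the type of the vertex with label $k+1$, for $1\le k<n$; 4. for every $\varepsilon>0$, $$\lim_{\delta\downarrow0}\ \limsup_{n\to\infty}\ \sup_{t\in[0,T]}\ \frac T\delta\,\mathbb P\Big(C_n(t,\delta)>\varepsilon\tbinom n2\Big)=0 .$$ Then $h^{G_n}\Rightarrow g^{[F]}$ as $n\to\infty$ in $D((\mathscr W,d_\square),[0,T])$, where $\Rightarrow$ denotes convergence in distribution. -/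

import Mathlib

open MeasureTheory ProbabilityTheory Filter Topology Set
open scoped unitInterval ENNReal

noncomputable section

/-! ### Càdlàg paths and the Skorokhod space -/

/-- The time interval `[0, T]`. -/
abbrev TimeInterval (T : ℝ) : Type := Icc (0 : ℝ) T

/-- Right-continuous with left limits. -/
structure IsCadlag {E : Type*} [TopologicalSpace E] {T : ℝ} (x : TimeInterval T → E) : Prop where
  rightContinuous : ∀ t, ContinuousWithinAt x (Ici t) t
  leftLimit : ∀ t : TimeInterval T, 0 < (t : ℝ) → ∃ l, Tendsto x (𝓝[<] t) (𝓝 l)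

/-- The space `D(E, [0, T])` of càdlàg paths. -/
structure SkorokhodSpace (E : Type*) [TopologicalSpace E] (T : ℝ) where
  toFun : TimeInterval T → E
  isCadlag : IsCadlag toFun

instance {E : Type*} [TopologicalSpace E] {T : ℝ} :
    CoeFun (SkorokhodSpace E T) (fun _ => TimeInterval T → E) := ⟨SkorokhodSpace.toFun⟩

lemma IsCadlag.comp {E E' : Type*} [TopologicalSpace E] [TopologicalSpace E'] {T : ℝ}
    {x : TimeInterval T → E} (hx : IsCadlag x) {φ : E → E'} (hφ : Continuous φ) :
    IsCadlag (fun t => φ (x t)) where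
  rightContinuous t := hφ.continuousAt.comp_continuousWithinAt (hx.rightContinuous t)
  leftLimit t ht := by
    obtain ⟨l, hl⟩ := hx.leftLimit t ht
    exact ⟨φ l, (hφ.tendsto l).comp hl⟩

/-- The image of a càdlàg path under a continuous map. -/
def SkorokhodSpace.map {E E' : Type*} [TopologicalSpace E] [TopologicalSpace E'] {T : ℝ}
    (φ : E → E') (hφ : Continuous φ) (x : SkorokhodSpace E T) : SkorokhodSpace E' T :=
  ⟨fun t => φ (x t), x.isCadlag.comp hφ⟩

/-- The Skorokhod (J1) distance on `D(E, [0, T])`: the infimum over all increasing bijections `τ`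
of `[0, T]` of `max (sup_t |τ t - t|) (sup_t d (x t) (y (τ t)))`. -/
instance {E : Type*} [PseudoEMetricSpace E] {T : ℝ} :
    PseudoEMetricSpace (SkorokhodSpace E T) where
  edist x y := ⨅ τ : TimeInterval T ≃o TimeInterval T,
    max (⨆ t, edist (τ t) t) (⨆ t, edist (x t) (y (τ t)))
  edist_self x := by
    refine le_antisymm (iInf_le_of_le (OrderIso.refl _) ?_) bot_le
    simp
  edist_comm x y := by
    have key : ∀ x y : SkorokhodSpace E T,
        (⨅ τ : TimeInterval T ≃o TimeInterval T,
          max (⨆ t, edist (τ t) t) (⨆ t, edist (x t) (y (τ t)))) ≤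
        ⨅ τ : TimeInterval T ≃o TimeInterval T,
          max (⨆ t, edist (τ t) t) (⨆ t, edist (y t) (x (τ t))) := by
      intro x y
      refine le_iInf fun τ => iInf_le_of_le τ.symm ?_
      refine max_le_max (iSup_le fun t => ?_) (iSup_le fun t => ?_)
      · refine le_iSup_of_le (τ.symm t) ?_
        rw [OrderIso.apply_symm_apply, edist_comm]
      · refine le_iSup_of_le (τ.symm t) ?_
        rw [OrderIso.apply_symm_apply, edist_comm]
    exact le_antisymm (key x y) (key y x)
  edist_triangle x y z := by
    rw [ENNReal.iInf_add]
    refine le_iInf fun ρ => ?_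
    rw [ENNReal.add_iInf]
    refine le_iInf fun τ => iInf_le_of_le (ρ.trans τ) (max_le ?_ ?_)
    · refine iSup_le fun t => (edist_triangle _ (ρ t) _).trans ?_
      rw [add_comm]
      exact add_le_add (le_max_of_le_left (le_iSup (fun t => edist (ρ t) t) t))
        (le_max_of_le_left (le_iSup (fun t => edist (τ t) t) (ρ t)))
    · refine iSup_le fun t => (edist_triangle _ (y (ρ t)) _).trans ?_
      exact add_le_add (le_max_of_le_right (le_iSup (fun t => edist (x t) (y (ρ t))) t))
        (le_max_of_le_right (le_iSup (fun t => edist (y t) (z (τ t))) (ρ t)))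

instance {E : Type*} [PseudoEMetricSpace E] {T : ℝ} : MeasurableSpace (SkorokhodSpace E T) :=
  borel _

instance {E : Type*} [PseudoEMetricSpace E] {T : ℝ} : BorelSpace (SkorokhodSpace E T) := ⟨rfl⟩

/-! ### Graphons -/

/-- The space `𝒲` of graphons: symmetric measurable functions `[0,1]² → [0,1]`, modulo almost
everywhere equality. -/
def Graphon : Type :=
  {h : (I × I) →ₘ[volume] ℝ // ∃ f : I × I → ℝ, Measurable f ∧ (∀ x y, f (x, y) = f (y, x)) ∧
    (∀ p, f p ∈ Icc (0 : ℝ) 1) ∧ h =ᵐ[volume] f}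

instance : CoeFun Graphon (fun _ => I × I → ℝ) := ⟨fun h => h.1⟩

/-- The class of a symmetric measurable function with values in `[0,1]`. -/
def Graphon.mk (f : I × I → ℝ) (hf : Measurable f) (hsymm : ∀ x y, f (x, y) = f (y, x))
    (hmem : ∀ p, f p ∈ Icc (0 : ℝ) 1) : Graphon :=
  ⟨AEEqFun.mk f hf.aestronglyMeasurable, f, hf, hsymm, hmem, AEEqFun.coeFn_mk _ _⟩

lemma Graphon.integrable (h : Graphon) : Integrable h (volume : Measure (I × I)) := by
  obtain ⟨h, f, hf, -, hmem, hae⟩ := h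
  refine Integrable.congr ?_ hae.symm
  refine Integrable.of_bound hf.aestronglyMeasurable 1 (ae_of_all _ fun p => ?_)
  rw [Real.norm_eq_abs, abs_of_nonneg (hmem p).1]
  exact (hmem p).2

/-- `‖h₁ - h₂‖_{L¹}`. -/
def l1Dist (h₁ h₂ : Graphon) : ℝ := ∫ p : I × I, |h₁ p - h₂ p|

/-- The cut distance `d_□`. -/
def cutDist (h₁ h₂ : Graphon) : ℝ :=
  ⨆ A : {A : Set I × Set I // MeasurableSet A.1 ∧ MeasurableSet A.2},
    |∫ p in A.1.1 ×ˢ A.1.2, (h₁ p - h₂ p)|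

lemma abs_setIntegral_le_l1Dist (h₁ h₂ : Graphon) (s : Set (I × I)) :
    |∫ p in s, (h₁ p - h₂ p)| ≤ l1Dist h₁ h₂ :=
  (abs_integral_le_integral_abs).trans
    (setIntegral_le_integral (h₁.integrable.sub h₂.integrable).abs
      (ae_of_all _ fun _ => abs_nonneg _))

lemma bddAbove_cut (h₁ h₂ : Graphon) :
    BddAbove (range fun A : {A : Set I × Set I // MeasurableSet A.1 ∧ MeasurableSet A.2} =>
      |∫ p in A.1.1 ×ˢ A.1.2, (h₁ p - h₂ p)|) :=
  ⟨l1Dist h₁ h₂, by rintro _ ⟨A, rfl⟩; exact abs_setIntegral_le_l1Dist h₁ h₂ _⟩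

instance : Nonempty {A : Set I × Set I // MeasurableSet A.1 ∧ MeasurableSet A.2} :=
  ⟨⟨(∅, ∅), .empty, .empty⟩⟩

lemma cutDist_le_l1Dist (h₁ h₂ : Graphon) : cutDist h₁ h₂ ≤ l1Dist h₁ h₂ :=
  ciSup_le fun _ => abs_setIntegral_le_l1Dist h₁ h₂ _

/-- The space `(𝒲, ‖·‖_{L¹})`. -/
def L1Graphon : Type := Graphon

/-- The space `(𝒲, d_□)`. -/
def CutGraphon : Type := Graphon

/-- A graphon as a point of `(𝒲, ‖·‖_{L¹})`. -/
def Graphon.toL1 (h : Graphon) : L1Graphon := h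

/-- A graphon as a point of `(𝒲, d_□)`. -/
def Graphon.toCut (h : Graphon) : CutGraphon := h

instance : PseudoMetricSpace L1Graphon where
  dist h₁ h₂ := l1Dist h₁ h₂
  dist_self h := by simp [l1Dist]
  dist_comm h₁ h₂ := by simp only [l1Dist, abs_sub_comm]
  dist_triangle h₁ h₂ h₃ := by
    have i (a b : Graphon) : Integrable (fun p => |a p - b p|) (volume : Measure (I × I)) :=
      (a.integrable.sub b.integrable).abs
    unfold l1Dist
    rw [← integral_add (i h₁ h₂) (i h₂ h₃)]
    exact integral_mono (i h₁ h₃) ((i h₁ h₂).add (i h₂ h₃)) fun p => abs_sub_le _ _ _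

instance : PseudoMetricSpace CutGraphon where
  dist h₁ h₂ := cutDist h₁ h₂
  dist_self h := by simp [cutDist]
  dist_comm h₁ h₂ := by
    refine iSup_congr fun A => ?_
    rw [← abs_neg, ← integral_neg]
    simp only [neg_sub]
  dist_triangle h₁ h₂ h₃ := by
    refine ciSup_le fun A => ?_
    refine le_trans ?_ (add_le_add (le_ciSup (bddAbove_cut h₁ h₂) A)
      (le_ciSup (bddAbove_cut h₂ h₃) A))
    have i (a b : Graphon) : IntegrableOn (fun p => a p - b p) (A.1.1 ×ˢ A.1.2) volume :=
      (a.integrable.sub b.integrable).integrableOn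
    refine le_trans (le_of_eq ?_) (abs_add_le _ _)
    rw [← integral_add (i h₁ h₂) (i h₂ h₃)]
    simp only [sub_add_sub_cancel]

/-- The identity map from `(𝒲, ‖·‖_{L¹})` to `(𝒲, d_□)`. -/
def L1Graphon.toCut (h : L1Graphon) : CutGraphon := h

lemma L1Graphon.continuous_toCut : Continuous L1Graphon.toCut :=
  (LipschitzWith.of_dist_le_mul (K := 1) fun h₁ h₂ => by
    rw [NNReal.coe_one, one_mul]; exact cutDist_le_l1Dist h₁ h₂).continuous

/-- The empirical graphon of a graph with vertex set `{1, …, n}`; the element `i` of `Fin n` stands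
for vertex `i + 1`. -/
def empiricalGraphon {n : ℕ+} (G : SimpleGraph (Fin n)) : Graphon :=
  Graphon.mk
    (indicator {p : I × I | ∃ i j : Fin n, ⌈(n : ℝ) * p.1⌉₊ = (i : ℕ) + 1 ∧
      ⌈(n : ℝ) * p.2⌉₊ = (j : ℕ) + 1 ∧ G.Adj i j} 1)
    (by
      refine measurable_one.indicator ?_
      simp only [Set.ofPred_exists]
      refine .iUnion fun i => .iUnion fun j => ?_
      refine .inter ?_ (.inter ?_ (.const _))
      · exact measurableSet_eq_fun (by fun_prop) measurable_const
      · exact measurableSet_eq_fun (by fun_prop) measurable_const)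
    (fun x y => by
      classical
      rw [indicator_apply, indicator_apply]
      refine if_congr ⟨?_, ?_⟩ rfl rfl <;>
      · rintro ⟨i, j, hi, hj, h⟩
        exact ⟨j, i, hj, hi, h.symm⟩)
    (fun p => by
      classical
      rw [indicator_apply]
      split_ifs <;> simp)

/-! ### Type distributions and the induced reference graphon -/

/-- The space `ℳ([0,1])` of probability distributions on `[0,1]` with the topology of weak
convergence, here metrised by the Lévy-Prokhorov distance. -/
abbrev TypeDistribution : Type := LevyProkhorov (ProbabilityMeasure I)

/-- The space `D(ℳ([0,1]), [0,T])`. -/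
abbrev TypePath (T : ℝ) : Type := SkorokhodSpace TypeDistribution T

/-- The distribution function `x ↦ F(x)`. -/
def TypeDistribution.cdf (F : TypeDistribution) (x : I) : ℝ :=
  (F.toMeasure : Measure I).real (Iic x)

/-- The right-continuous generalised inverse `u ↦ inf {x ∈ [0,1] | F(x) > u}`. At `u = 1` the set is
empty and the value is `1`. -/
def TypeDistribution.inv (F : TypeDistribution) (u : I) : I := sInf {x | (u : ℝ) < F.cdf x}

lemma TypeDistribution.measurable_inv (F : TypeDistribution) : Measurable F.inv :=
  Monotone.measurable fun _ _ huv => sInf_le_sInf fun _ hx =>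
    lt_of_le_of_lt (Subtype.coe_le_coe.2 huv) hx

/-- The empirical measure `n⁻¹ ∑ᵢ δ_{xᵢ}`. -/
def empiricalType {n : ℕ+} (x : Fin n → I) : TypeDistribution :=
  .ofMeasure ⟨(n : ℝ≥0∞)⁻¹ • ∑ i, Measure.dirac (x i), ⟨by
    simp [ENNReal.inv_mul_cancel]⟩⟩

/-- The function `H(t; u, v, F)`, symmetric in the types `u` and `v`: the probability that an edge
between vertices of types `u` and `v` is active at time `t` if the path of type distributions is
`F`. -/
structure EdgeProbability (T : ℝ) where
  toFun : TimeInterval T → I → I → TypePath T → I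
  symm : ∀ t u v F, toFun t u v F = toFun t v u F
  measurable : ∀ t F, Measurable fun p : I × I => toFun t p.1 p.2 F

namespace EdgeProbability

variable {T : ℝ}

instance : CoeFun (EdgeProbability T) (fun _ => TimeInterval T → I → I → TypePath T → I) :=
  ⟨EdgeProbability.toFun⟩

/-- The induced reference graphon `g^{[F]}(t; x, y) = H(t; F̄(t; x), F̄(t; y), F)`. -/
def refGraphon (H : EdgeProbability T) (F : TypePath T) (t : TimeInterval T) : Graphon :=
  Graphon.mk (fun p => H t ((F t).inv p.1) ((F t).inv p.2) F)
    (measurable_subtype_coe.comp ((H.measurable t F).comp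
      (((F t).measurable_inv.comp measurable_fst).prodMk
        ((F t).measurable_inv.comp measurable_snd))))
    (fun x y => by rw [H.symm])
    (fun p => (H t ((F t).inv p.1) ((F t).inv p.2) F).2)

/-- `F ↦ g^{[F]}` is a continuous map from `D(ℳ([0,1]), [0,T])` to `D((𝒲, ‖·‖_{L¹}), [0,T])`. -/
structure IsContinuous (H : EdgeProbability T) : Prop where
  cadlag : ∀ F, IsCadlag fun t => (H.refGraphon F t).toL1
  continuous : Continuous fun F : TypePath T =>
    (⟨fun t => (H.refGraphon F t).toL1, cadlag F⟩ : SkorokhodSpace L1Graphon T)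

/-- The process `g^{[F]}` as an element of `D((𝒲, d_□), [0,T])`. -/
def IsContinuous.cutPath {H : EdgeProbability T} (hH : H.IsContinuous) (F : TypePath T) :
    SkorokhodSpace CutGraphon T :=
  SkorokhodSpace.map L1Graphon.toCut L1Graphon.continuous_toCut
    ⟨fun t => (H.refGraphon F t).toL1, hH.cadlag F⟩

end EdgeProbability

/-! ### The graph-valued process -/

/-- The edges `ij` with `i < j`. -/
def edgePairs (n : ℕ) : Finset (Fin n × Fin n) := Finset.univ.filter fun p => p.1 < p.2

/-- A graph-valued process on `n` vertices with edge probability `H`, in which vertex `i` carries at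
time `t` the type `X i t`. The types evolve autonomously: given all of them, the edges present at
time `t` are independent and the edge `ij` is active with probability
`H(t; X i t, X j t, F_n)`. Nothing is prescribed about the joint law of the edges at several times.

At each time the vertices carry labels: `label t ω k` is the vertex which has label `k`. A fixed
labelling, or vertices that are identified with their labels, correspond to `label t ω` being the
identity. -/
structure GraphProcess {T : ℝ} (H : EdgeProbability T) (n : ℕ+) {Ω : Type*} [MeasurableSpace Ω]
    (P : Measure Ω) where
  /-- The types. -/
  X : Fin n → TimeInterval T → Ω → I
  measurable_X : ∀ i t, Measurable (X i t)
  /-- The process of empirical type distributions, which lives on `D(ℳ([0,1]), [0,T])`. -/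
  F : Ω → TypePath T
  F_apply : ∀ ω t, F ω t = empiricalType fun i => X i t ω
  /-- The graph on the vertices. -/
  G : TimeInterval T → Ω → SimpleGraph (Fin n)
  measurable_G : ∀ t i j, MeasurableSet {ω | (G t ω).Adj i j}
  /-- The conditional law of the graph at time `t` given the types. -/
  condLaw : ∀ t (γ : SimpleGraph (Fin n)),
    P[({ω | G t ω = γ}).indicator (fun _ => (1 : ℝ)) |
        ⨆ i, ⨆ s, MeasurableSpace.comap (X i s) inferInstance] =ᵐ[P]
      fun ω => open Classical in ∏ p ∈ edgePairs n,
        if γ.Adj p.1 p.2 then (H t (X p.1 t ω) (X p.2 t ω) (F ω) : ℝ)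
        else 1 - (H t (X p.1 t ω) (X p.2 t ω) (F ω) : ℝ)
  /-- The labelling of the vertices. -/
  label : TimeInterval T → Ω → Equiv.Perm (Fin n)
  /-- The process of empirical graphons `h^{G_n}` of the labelled graphs, a random element of
  `D((𝒲, d_□), [0,T])`. -/
  h : Ω → SkorokhodSpace CutGraphon T
  h_apply : ∀ ω t, h ω t = (empiricalGraphon ((G t ω).comap (label t ω))).toCut
  aemeasurable_h : AEMeasurable h P

namespace GraphProcess

variable {T : ℝ} {H : EdgeProbability T} {n : ℕ+} {Ω : Type*} [MeasurableSpace Ω] {P : Measure Ω}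

/-- The indicator `E_{ij}(t)` that the edge `ij` is active at time `t`. -/
def E (𝒢 : GraphProcess H n P) (i j : Fin n) (t : TimeInterval T) (ω : Ω) : ℝ :=
  open Classical in if (𝒢.G t ω).Adj i j then 1 else 0

/-- The number `C_n(t, δ) = ∑_{i < j} sup_{t ≤ u ≤ v ≤ t + δ} |E_{ij}(u) - E_{ij}(v)|` of edges that
change between times `t` and `t + δ`; the times `u, v` range over `[0, T]`. -/
def C (𝒢 : GraphProcess H n P) (t : TimeInterval T) (δ : ℝ) (ω : Ω) : ℝ :=
  ∑ p ∈ edgePairs n,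
    ⨆ q : {q : TimeInterval T × TimeInterval T // t ≤ q.1 ∧ q.1 ≤ q.2 ∧ (q.2 : ℝ) ≤ t + δ},
      |𝒢.E p.1 p.2 q.1.1 ω - 𝒢.E p.1 p.2 q.1.2 ω|

/-- At every time the labels are such that `X_1(t) ≤ ⋯ ≤ X_n(t)`. -/
def OrderedLabels (𝒢 : GraphProcess H n P) : Prop :=
  ∀ t ω, Monotone fun k => 𝒢.X (𝒢.label t ω k) t ω

end GraphProcess

/-- For every `ε > 0`,
`lim_{δ ↓ 0} limsup_{n → ∞} sup_{t ∈ [0,T]} (T/δ) P(C_n(t, δ) > ε (n choose 2)) = 0`. -/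
def UniformEdgeChange {T : ℝ} {H : EdgeProbability T} {Ω : ℕ+ → Type*}
    [∀ n, MeasurableSpace (Ω n)] {P : ∀ n, Measure (Ω n)} (𝒢 : ∀ n, GraphProcess H n (P n)) :
    Prop :=
  ∀ ε : ℝ, 0 < ε →
    Tendsto (fun δ : ℝ => limsup (fun n : ℕ+ => ⨆ t : TimeInterval T,
        ENNReal.ofReal (T / δ) * P n {ω | (𝒢 n).C t δ ω > ε * ((n : ℕ).choose 2 : ℝ)}) atTop)
      (𝓝[>] 0) (𝓝 0)

end

/-!
The map `F ↦ g^{[F]}` is continuous, so `g^{[F_n]}` converges in distribution to `g^{[F]}`. By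
Slutsky's theorem (`tendstoInDistribution_of_tendsto_measure_edist`) it suffices that `h^{G_n}` and
`g^{[F_n]}` are uniformly close in cut distance with high probability
(`tendsto_measure_edist_h_cutPath`).

Because the labels are ordered by type, both graphons at time `u` are step functions on the same
grid: the values are `1{ij ∈ G_n(u)}` and the conditional edge probabilities `p_{ij}(u)`, relabelled
by the same permutation (`ae_empiricalGraphon`, `ae_refGraphon`). Their cut distance is at most
`n⁻²` times the cut norm of the matrix `1{ij ∈ G_n(u)} - p_{ij}(u)`
(`cutDist_le_of_cutNormLE`), and this cut norm does not depend on the labelling. So the labels may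
change in time as they like, and the matrix can be compared, vertex by vertex, with the one at the
preceding point `t` of a grid of width `δ` (`cutNormLE_adj_sub`):

* At the fixed time `t` the edges are conditionally independent, and a Chernoff bound for all pairs
  of vertex sets makes the cut norm of `1{ij ∈ G_n(t)} - p_{ij}(t)` small
  (`GraphProcess.measure_not_cutNormLE_le`).
* The number of edges that differ at times `t` and `u` is at most `C_n(t, δ)`.
* As `p_{ij}` is a conditional expectation of the edge indicator given the types,
  `∑ |p_{ij}(u) - p_{ij}(t)|` is at most the conditional expectation of the number of changing edges
  (`GraphProcess.abs_prob_sub_prob_le`). By Markov's inequality this exceeds `2ηK`, with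
  `K = n(n-1)/2`, with probability at most `η⁻¹ P(C_n(t, δ) > ηK)` (`measure_sum_condExp_gt_le`).

Summing over the `O(T/δ)` points of the grid gives exactly the quantity which the hypothesis on edge
changes controls, plus a term that vanishes as `n → ∞` for fixed `δ`. The conditional bounds hold
almost surely for countably many times `u` only; right-continuity of both paths extends the
comparison to all times (`SkorokhodSpace.edist_le_of_dense`).
-/

/-! ### Convergence in distribution and the Skorokhod distance -/

/-- **Slutsky's theorem** in a pseudo-emetric space that need not be separable: the distance of the
two sequences may fail to be measurable, and its smallness is expressed with outer measures. -/
theorem tendstoInDistribution_of_tendsto_measure_edist {ι E Ω' : Type*} {Ω : ι → Type*}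
    [∀ i, MeasurableSpace (Ω i)] {μ : ∀ i, Measure (Ω i)} [∀ i, IsProbabilityMeasure (μ i)]
    [MeasurableSpace Ω'] {μ' : Measure Ω'} [IsProbabilityMeasure μ']
    [PseudoEMetricSpace E] [MeasurableSpace E] [BorelSpace E] {l : Filter ι}
    [l.IsCountablyGenerated] {X Y : ∀ i, Ω i → E} {Z : Ω' → E}
    (hX : TendstoInDistribution X l Z μ μ') (hY : ∀ i, AEMeasurable (Y i) (μ i))
    (hXY : ∀ ε : ℝ, 0 < ε →
      Tendsto (fun i => μ i {ω | ENNReal.ofReal ε < edist (Y i ω) (X i ω)}) l (𝓝 0)) :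
    TendstoInDistribution Y l Z μ μ' := by
  refine ⟨hY, hX.aemeasurable_limit, ?_⟩
  refine tendsto_of_forall_isClosed_limsup_le' fun F hF => ?_
  have hthick : Tendsto (fun ε => μ'.map Z (Metric.cthickening ε F)) (𝓝[>] 0)
      (𝓝 (μ'.map Z F)) := by
    have := Measure.isProbabilityMeasure_map hX.aemeasurable_limit
    exact (tendsto_measure_cthickening_of_isClosed
      ⟨1, one_pos, measure_ne_top _ _⟩ hF).mono_left nhdsWithin_le_nhds
  refine ge_of_tendsto hthick ?_
  filter_upwards [self_mem_nhdsWithin] with ε (hε : 0 < ε)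
  have hbound : ∀ i, (μ i).map (Y i) F ≤ (μ i).map (X i) (Metric.cthickening ε F) +
      μ i {ω | ENNReal.ofReal ε < edist (Y i ω) (X i ω)} := by
    intro i
    rw [Measure.map_apply_of_aemeasurable (hY i) hF.measurableSet,
      Measure.map_apply_of_aemeasurable (hX.forall_aemeasurable i)
        Metric.isClosed_cthickening.measurableSet]
    refine (measure_mono fun ω hω => ?_).trans (measure_union_le _ _)
    by_cases h : ENNReal.ofReal ε < edist (Y i ω) (X i ω)
    · exact Or.inr h
    · left
      refine Metric.mem_cthickening_iff.2
        ((Metric.infEDist_le_edist_of_mem (show Y i ω ∈ F from hω)).trans ?_)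
      rw [edist_comm (X i ω)]
      exact not_lt.1 h
  have hlim := ProbabilityMeasure.limsup_measure_closed_le_of_tendsto hX.tendsto
    (Metric.isClosed_cthickening (δ := ε) (E := F))
  calc limsup (fun i => (μ i).map (Y i) F) l
      ≤ limsup ((fun i => (μ i).map (X i) (Metric.cthickening ε F)) +
          fun i => μ i {ω | ENNReal.ofReal ε < edist (Y i ω) (X i ω)}) l :=
        limsup_le_limsup (.of_forall hbound)
    _ = limsup (fun i => (μ i).map (X i) (Metric.cthickening ε F)) l :=
        ENNReal.limsup_add_of_right_tendsto_zero (hXY ε hε) _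
    _ ≤ μ'.map Z (Metric.cthickening ε F) := hlim

lemma SkorokhodSpace.edist_le_iSup {E : Type*} [PseudoEMetricSpace E] {T : ℝ}
    (x y : SkorokhodSpace E T) : edist x y ≤ ⨆ t, edist (x t) (y t) := by
  refine iInf_le_of_le (OrderIso.refl _) ?_
  simp

lemma SkorokhodSpace.continuous_map {E E' : Type*} [PseudoEMetricSpace E] [PseudoEMetricSpace E']
    {T : ℝ} {φ : E → E'} (hφ : LipschitzWith 1 φ) :
    Continuous (SkorokhodSpace.map (T := T) φ hφ.continuous) := by
  have h : LipschitzWith 1 (SkorokhodSpace.map (T := T) φ hφ.continuous) := by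
    intro x y
    rw [ENNReal.coe_one, one_mul]
    refine iInf_mono fun τ => max_le_max le_rfl (iSup_mono fun t => ?_)
    exact (hφ (x t) (y (τ t))).trans_eq (by simp)
  exact h.continuous

lemma L1Graphon.lipschitzWith_toCut : LipschitzWith 1 L1Graphon.toCut :=
  LipschitzWith.of_dist_le_mul fun h₁ h₂ => by
    rw [NNReal.coe_one, one_mul]
    exact cutDist_le_l1Dist h₁ h₂

lemma EdgeProbability.IsContinuous.continuous_cutPath {T : ℝ} {H : EdgeProbability T}
    (hH : H.IsContinuous) : Continuous hH.cutPath :=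
  (SkorokhodSpace.continuous_map L1Graphon.lipschitzWith_toCut).comp hH.continuous

/-- By right-continuity, the uniform distance of two càdlàg paths is determined on any dense set of
times that contains the final time. -/
lemma SkorokhodSpace.edist_le_of_dense {E : Type*} [PseudoEMetricSpace E] {T : ℝ}
    (x y : SkorokhodSpace E T) {D : Set (TimeInterval T)} (hD : Dense D)
    (hT : ∀ t : TimeInterval T, (t : ℝ) = T → t ∈ D) {c : ℝ≥0∞}
    (hc : ∀ t ∈ D, edist (x t) (y t) ≤ c) : edist x y ≤ c := by
  refine (x.edist_le_iSup y).trans (iSup_le fun t => ?_)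
  rcases t.2.2.eq_or_lt with ht | ht
  · exact hc t (hT t ht)
  have hne : (𝓝[Ioi t ∩ D] t).NeBot := by
    rw [← mem_closure_iff_nhdsWithin_neBot]
    refine closure_minimal (hD.open_subset_closure_inter isOpen_Ioi) isClosed_closure ?_
    rw [closure_Ioi' ⟨⟨T, t.2.1.trans t.2.2, le_rfl⟩, ht⟩]
    exact self_mem_Ici
  have hmono : 𝓝[Ioi t ∩ D] t ≤ 𝓝[Ici t] t :=
    nhdsWithin_mono _ fun s hs => (mem_Ioi.1 hs.1).le
  have hx : Tendsto x (𝓝[Ioi t ∩ D] t) (𝓝 (x t)) := (x.isCadlag.rightContinuous t).mono_left hmono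
  have hy : Tendsto y (𝓝[Ioi t ∩ D] t) (𝓝 (y t)) := (y.isCadlag.rightContinuous t).mono_left hmono
  refine le_of_tendsto (hx.edist hy) ?_
  filter_upwards [self_mem_nhdsWithin] with s hs using hc s hs.2

/-! ### Cut norms of matrices -/

/-- The cut norm `max_{S, S'} |∑_{i ∈ S, j ∈ S'} Aᵢⱼ|` of the matrix `A` is at most `c`. -/
def CutNormLE {ι : Type*} (A : ι → ι → ℝ) (c : ℝ) : Prop :=
  ∀ S S' : Finset ι, |∑ i ∈ S, ∑ j ∈ S', A i j| ≤ c

lemma exists_abs_sum_mul_le {ι : Type*} [Fintype ι] (α c : ι → ℝ) (hα : ∀ i, α i ∈ Icc (0 : ℝ) 1) :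
    ∃ S : Finset ι, |∑ i, α i * c i| ≤ |∑ i ∈ S, c i| := by
  classical
  rcases le_total 0 (∑ i, α i * c i) with h | h
  · refine ⟨Finset.univ.filter fun i => 0 ≤ c i, ?_⟩
    rw [abs_of_nonneg h]
    refine le_trans ?_ (le_abs_self _)
    rw [Finset.sum_filter]
    refine Finset.sum_le_sum fun i _ => ?_
    split_ifs with hc
    · exact mul_le_of_le_one_left hc (hα i).2
    · exact mul_nonpos_of_nonneg_of_nonpos (hα i).1 (not_le.1 hc).le
  · refine ⟨Finset.univ.filter fun i => c i ≤ 0, ?_⟩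
    rw [abs_of_nonpos h]
    refine le_trans ?_ (neg_le_abs _)
    rw [Finset.sum_filter]
    refine neg_le_neg (Finset.sum_le_sum fun i _ => ?_)
    split_ifs with hc
    · nlinarith [(hα i).2]
    · exact mul_nonneg (hα i).1 (not_le.1 hc).le

namespace CutNormLE

variable {ι : Type*} {A B : ι → ι → ℝ} {a b : ℝ}

/-- The cut norm also bounds the bilinear form on weights in `[0,1]`, since a linear function on a
cube is extremal at vertices. -/
lemma weighted [Fintype ι] (h : CutNormLE A a) (α β : ι → ℝ) (hα : ∀ i, α i ∈ Icc (0 : ℝ) 1)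
    (hβ : ∀ i, β i ∈ Icc (0 : ℝ) 1) : |∑ i, ∑ j, A i j * (α i * β j)| ≤ a := by
  obtain ⟨S, hS⟩ := exists_abs_sum_mul_le α (fun i => ∑ j, A i j * β j) hα
  obtain ⟨S', hS'⟩ := exists_abs_sum_mul_le β (fun j => ∑ i ∈ S, A i j) hβ
  calc |∑ i, ∑ j, A i j * (α i * β j)| = |∑ i, α i * ∑ j, A i j * β j| := by
        congr 1
        refine Finset.sum_congr rfl fun i _ => ?_
        rw [Finset.mul_sum]
        exact Finset.sum_congr rfl fun j _ => by ring
    _ ≤ _ := hS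
    _ = |∑ j, β j * ∑ i ∈ S, A i j| := by
        rw [Finset.sum_comm]
        congr 1
        refine Finset.sum_congr rfl fun j _ => ?_
        rw [Finset.mul_sum]
        exact Finset.sum_congr rfl fun j _ => by ring
    _ ≤ _ := hS'
    _ ≤ a := by
        rw [Finset.sum_comm]
        exact h S S'

lemma add (hA : CutNormLE A a) (hB : CutNormLE B b) :
    CutNormLE (fun i j => A i j + B i j) (a + b) := by
  intro S S'
  simp only [Finset.sum_add_distrib]
  exact (abs_add_le _ _).trans (add_le_add (hA S S') (hB S S'))

lemma of_sum_abs_le [Fintype ι] (h : ∑ i, ∑ j, |A i j| ≤ a) : CutNormLE A a := by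
  intro S S'
  calc |∑ i ∈ S, ∑ j ∈ S', A i j| ≤ ∑ i ∈ S, ∑ j ∈ S', |A i j| :=
        (Finset.abs_sum_le_sum_abs _ _).trans
          (Finset.sum_le_sum fun i _ => Finset.abs_sum_le_sum_abs _ _)
    _ ≤ ∑ i ∈ S, ∑ j, |A i j| := Finset.sum_le_sum fun i _ =>
        Finset.sum_le_sum_of_subset_of_nonneg (Finset.subset_univ _) fun _ _ _ => abs_nonneg _
    _ ≤ ∑ i, ∑ j, |A i j| :=
        Finset.sum_le_sum_of_subset_of_nonneg (Finset.subset_univ _) fun _ _ _ =>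
          Finset.sum_nonneg fun _ _ => abs_nonneg _
    _ ≤ a := h

lemma comp_perm (h : CutNormLE A a) (e : Equiv.Perm ι) :
    CutNormLE (fun i j => A (e i) (e j)) a := by
  intro S S'
  simpa using h (S.map e.toEmbedding) (S'.map e.toEmbedding)

end CutNormLE

/-! ### Step graphons -/

/-- The `i`-th of the `n` intervals `(i/n, (i+1)/n]` of `[0,1]`. -/
def cell (n : ℕ+) (i : Fin n) : Set I := {x | ⌈(n : ℝ) * x⌉₊ = (i : ℕ) + 1}

lemma measurableSet_cell (n : ℕ+) (i : Fin n) : MeasurableSet (cell n i) :=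
  measurableSet_eq_fun (by fun_prop) measurable_const

lemma mem_cell_iff {n : ℕ+} {i : Fin n} {x : I} :
    x ∈ cell n i ↔ (i : ℝ) < n * x ∧ (n : ℝ) * x ≤ i + 1 := by
  have := Nat.ceil_eq_iff (R := ℝ) (a := n * (x : ℝ)) (n := (i : ℕ) + 1) (Nat.succ_ne_zero _)
  simpa [cell] using this

lemma volume_real_cell_le (n : ℕ+) (i : Fin n) :
    (volume : Measure I).real (cell n i) ≤ (n : ℝ)⁻¹ := by
  have hn : (0 : ℝ) < n := by exact_mod_cast n.pos
  have hi : ((i : ℕ) : ℝ) + 1 ≤ n := by exact_mod_cast i.2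
  have hi0 : (0 : ℝ) ≤ (i : ℕ) := Nat.cast_nonneg _
  have h1 : ((i : ℕ) : ℝ) / n ∈ I := ⟨by positivity, by rw [div_le_one hn]; linarith⟩
  have h2 : (((i : ℕ) : ℝ) + 1) / n ∈ I := ⟨by positivity, by rw [div_le_one hn]; linarith⟩
  have hsub : cell n i ⊆ Ioc ⟨_, h1⟩ ⟨_, h2⟩ := by
    intro x hx
    rw [mem_cell_iff] at hx
    refine ⟨?_, ?_⟩
    · rw [← Subtype.coe_lt_coe, div_lt_iff₀' hn]
      exact hx.1
    · rw [← Subtype.coe_le_coe, le_div_iff₀' hn]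
      exact hx.2
  refine (measureReal_mono hsub).trans ?_
  rw [measureReal_def, unitInterval.volume_Ioc]
  rw [ENNReal.toReal_ofReal] <;> simp only
  · apply le_of_eq
    field_simp
    ring
  · rw [sub_nonneg]
    gcongr
    linarith

lemma exists_mem_cell (n : ℕ+) {x : I} (hx : x ≠ 0) : ∃ i, x ∈ cell n i := by
  have hn : (0 : ℝ) < n := by exact_mod_cast n.pos
  have hx0 : (0 : ℝ) < x := unitInterval.pos_iff_ne_zero.2 hx
  have h1 : 0 < ⌈(n : ℝ) * x⌉₊ := Nat.ceil_pos.2 (by positivity)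
  have h2 : ⌈(n : ℝ) * x⌉₊ ≤ n := Nat.ceil_le.2 (mul_le_of_le_one_right hn.le x.2.2)
  exact ⟨⟨⌈(n : ℝ) * x⌉₊ - 1, by omega⟩, by simp only [cell, mem_ofPred_eq]; omega⟩

lemma cell_disjoint {n : ℕ+} {i j : Fin n} {x : I} (hi : x ∈ cell n i) (hj : x ∈ cell n j) :
    i = j := by
  simp only [cell, mem_ofPred_eq] at hi hj
  exact Fin.ext (by omega)

lemma ae_fst_snd {p : I → Prop} (h : ∀ᵐ x : I, p x) : ∀ᵐ q : I × I, p q.1 ∧ p q.2 :=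
  (Measure.quasiMeasurePreserving_fst.ae h).and (Measure.quasiMeasurePreserving_snd.ae h)

/-- The cut distance of two graphons whose difference is a step function is controlled by the cut
norm of the matrix of its values. -/
lemma cutDist_le_of_cutNormLE {n : ℕ+} {h₁ h₂ : Graphon} {A : Fin n → Fin n → ℝ} {c : ℝ}
    (h : ∀ᵐ p : I × I, ∀ i j, p.1 ∈ cell n i → p.2 ∈ cell n j → h₁ p - h₂ p = A i j)
    (hA : CutNormLE A c) : cutDist h₁ h₂ ≤ c / (n : ℝ) ^ 2 := by
  have hn : (0 : ℝ) < n := by exact_mod_cast n.pos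
  have hstep : ∀ᵐ p : I × I, h₁ p - h₂ p =
      ∑ i, ∑ j, A i j * ((cell n i).indicator 1 p.1 * (cell n j).indicator 1 p.2) := by
    have h0 : ∀ᵐ x : I, x ≠ 0 := by simp [ae_iff]
    filter_upwards [h, ae_fst_snd h0] with p hp hp0
    obtain ⟨i, hi⟩ := exists_mem_cell n hp0.1
    obtain ⟨j, hj⟩ := exists_mem_cell n hp0.2
    rw [hp i j hi hj, Finset.sum_eq_single i, Finset.sum_eq_single j]
    · simp [hi, hj]
    · intro j' _ hj'
      rw [indicator_of_notMem (fun h' => hj' (cell_disjoint h' hj))]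
      simp
    · simp
    · intro i' _ hi'
      rw [indicator_of_notMem (fun h' => hi' (cell_disjoint h' hi))]
      simp
    · simp
  refine ciSup_le fun ⟨⟨S, S'⟩, hS, hS'⟩ => ?_
  simp only at hS hS' ⊢
  have hint : ∀ (μ : Measure I) [IsFiniteMeasure μ] (i : Fin n),
      Integrable ((cell n i).indicator (1 : I → ℝ)) μ := fun μ _ i =>
    (integrable_const (1 : ℝ)).indicator (measurableSet_cell n i)
  rw [integral_congr_ae (ae_restrict_of_ae hstep), Measure.volume_eq_prod, ← Measure.prod_restrict,
    integral_finsetSum _ fun i _ => integrable_finsetSum _ fun j _ =>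
      ((hint _ i).mul_prod (hint _ j)).const_mul _]
  have hval : ∀ i, ∫ p, ∑ j, A i j * ((cell n i).indicator 1 p.1 * (cell n j).indicator 1 p.2)
      ∂((volume.restrict S).prod (volume.restrict S')) = (n : ℝ)⁻¹ * (n : ℝ)⁻¹ *
      ∑ j, A i j * (((n : ℝ) * (volume.restrict S).real (cell n i)) *
        (n * (volume.restrict S').real (cell n j))) := by
    intro i
    rw [integral_finsetSum _ fun j _ => ((hint _ i).mul_prod (hint _ j)).const_mul _,
      Finset.mul_sum]
    refine Finset.sum_congr rfl fun j _ => ?_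
    rw [integral_const_mul, integral_prod_mul, integral_indicator_one (measurableSet_cell n i),
      integral_indicator_one (measurableSet_cell n j)]
    field_simp
  simp only [hval]
  rw [← Finset.mul_sum, abs_mul, abs_of_pos (by positivity), div_eq_inv_mul, sq, mul_inv]
  have hw : ∀ (V : Set I) (i : Fin n), (n : ℝ) * (volume.restrict V).real (cell n i) ∈
      Icc (0 : ℝ) 1 := by
    intro V i
    refine ⟨by positivity, ?_⟩
    rw [← mul_inv_cancel₀ hn.ne']
    gcongr
    refine le_trans ?_ (volume_real_cell_le n i)
    exact ENNReal.toReal_mono (measure_ne_top _ _) (Measure.restrict_apply_le _ _)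
  gcongr
  exact hA.weighted _ _ (hw S) (hw S')

lemma cdf_empiricalType {n : ℕ+} (x : Fin n → I) (z : I) :
    (empiricalType x).cdf z = (n : ℝ)⁻¹ * ((Finset.univ.filter fun i => x i ≤ z).card : ℝ) := by
  have h : ((empiricalType x).toMeasure : Measure I) =
      (n : ℝ≥0∞)⁻¹ • ∑ i, Measure.dirac (x i) := rfl
  rw [TypeDistribution.cdf, h, measureReal_def, Measure.smul_apply, Measure.finsetSum_apply,
    smul_eq_mul, ENNReal.toReal_mul, ENNReal.toReal_inv, ENNReal.toReal_natCast]
  congr 1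
  simp only [Measure.dirac_apply' _ measurableSet_Iic, indicator_apply, mem_Iic, Pi.one_apply]
  rw [Finset.sum_boole, ENNReal.toReal_natCast]

/-- On the interior of the `k`-th cell the generalised inverse of the empirical distribution
function is the `k`-th order statistic. -/
lemma inv_empiricalType {n : ℕ+} (x : Fin n → I) (e : Equiv.Perm (Fin n))
    (he : Monotone fun k => x (e k)) {k : Fin n} {v : I} (hv : v ∈ cell n k)
    (hv' : (n : ℝ) * v ≠ k + 1) : (empiricalType x).inv v = x (e k) := by
  have hn : (0 : ℝ) < n := by exact_mod_cast n.pos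
  rw [mem_cell_iff] at hv
  have hcard : ∀ z, (Finset.univ.filter fun i => x i ≤ z).card =
      (Finset.univ.filter fun i => x (e i) ≤ z).card := fun z =>
    (Finset.card_equiv e (by simp)).symm
  have hset : {z | (v : ℝ) < (empiricalType x).cdf z} = Ici (x (e k)) := by
    ext z
    rw [mem_ofPred_eq, cdf_empiricalType, ← div_eq_inv_mul, lt_div_iff₀' hn, hcard, mem_Ici]
    constructor
    · intro h
      by_contra! hz
      have hsub : (Finset.univ.filter fun i => x (e i) ≤ z) ⊆ Finset.Iio k := by
        intro i hi
        simp only [Finset.mem_filter, Finset.mem_univ, true_and] at hi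
        rw [Finset.mem_Iio]
        by_contra! hki
        exact absurd ((he hki).trans hi) (not_le.2 hz)
      have := Finset.card_le_card hsub
      rw [Fin.card_Iio] at this
      have : (((Finset.univ.filter fun i => x (e i) ≤ z).card : ℕ) : ℝ) ≤ (k : ℕ) := by
        exact_mod_cast this
      linarith [hv.1]
    · intro hz
      have hsub : Finset.Iic k ⊆ (Finset.univ.filter fun i => x (e i) ≤ z) := by
        intro i hi
        simp only [Finset.mem_filter, Finset.mem_univ, true_and]
        exact (he (Finset.mem_Iic.1 hi)).trans hz
      have := Finset.card_le_card hsub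
      rw [Fin.card_Iic] at this
      have : (((k : ℕ) : ℝ)) + 1 ≤ ((Finset.univ.filter fun i => x (e i) ≤ z).card : ℕ) := by
        exact_mod_cast this
      exact (lt_of_le_of_ne hv.2 hv').trans_le this
  rw [TypeDistribution.inv, hset, csInf_Ici]

lemma ae_mul_ne (n : ℕ+) : ∀ᵐ v : I, ∀ k : Fin n, (n : ℝ) * v ≠ k + 1 := by
  have hn : (0 : ℝ) < n := by exact_mod_cast n.pos
  rw [ae_all_iff]
  intro k
  rw [ae_iff]
  refine Set.Subsingleton.measure_zero ?_ _
  intro v hv w hw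
  simp only [not_not, mem_ofPred_eq] at hv hw
  exact Subtype.ext (mul_left_cancel₀ hn.ne' (hv.trans hw.symm))

lemma ae_empiricalGraphon {n : ℕ+} (G : SimpleGraph (Fin n)) :
    ∀ᵐ p : I × I, ∀ i j, p.1 ∈ cell n i → p.2 ∈ cell n j →
      empiricalGraphon G p = open Classical in if G.Adj i j then 1 else 0 := by
  classical
  have h : empiricalGraphon G =ᵐ[volume] indicator {p : I × I | ∃ i j : Fin n,
      ⌈(n : ℝ) * p.1⌉₊ = (i : ℕ) + 1 ∧ ⌈(n : ℝ) * p.2⌉₊ = (j : ℕ) + 1 ∧ G.Adj i j} 1 :=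
    AEEqFun.coeFn_mk _ _
  filter_upwards [h] with p hp i j hi hj
  rw [hp, indicator_apply]
  refine if_congr ⟨?_, fun hij => ⟨i, j, hi, hj, hij⟩⟩ rfl rfl
  rintro ⟨i', j', hi', hj', hij⟩
  rwa [cell_disjoint hi hi', cell_disjoint hj hj']

lemma ae_refGraphon {T : ℝ} (H : EdgeProbability T) (F : TypePath T) (t : TimeInterval T) {n : ℕ+}
    (x : Fin n → I) (hF : F t = empiricalType x) (e : Equiv.Perm (Fin n))
    (he : Monotone fun k => x (e k)) :
    ∀ᵐ p : I × I, ∀ i j, p.1 ∈ cell n i → p.2 ∈ cell n j →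
      H.refGraphon F t p = H t (x (e i)) (x (e j)) F := by
  have h : H.refGraphon F t =ᵐ[volume]
      fun p : I × I => (H t ((F t).inv p.1) ((F t).inv p.2) F : ℝ) := AEEqFun.coeFn_mk _ _
  filter_upwards [h, ae_fst_snd (ae_mul_ne n)] with p hp hne i j hi hj
  rw [hp, hF, inv_empiricalType x e he hi (hne.1 i), inv_empiricalType x e he hj (hne.2 j)]

/-! ### Random graphs with independent edges -/

lemma sum_sum_eq_sum_edgePairs {n : ℕ} (f : Fin n → Fin n → ℝ) (hf : ∀ i, f i i = 0) :
    ∑ i, ∑ j, f i j = ∑ e ∈ edgePairs n, (f e.1 e.2 + f e.2 e.1) := by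
  have hswap : ∑ e ∈ edgePairs n, f e.2 e.1 =
      ∑ e ∈ Finset.univ.filter fun e : Fin n × Fin n => e.2 < e.1, f e.1 e.2 := by
    refine Finset.sum_nbij' Prod.swap Prod.swap ?_ ?_ ?_ ?_ ?_ <;> simp [edgePairs]
  rw [Finset.sum_add_distrib, hswap, ← Finset.sum_product', Finset.univ_product_univ,
    ← Finset.sum_filter_add_sum_filter_not _ fun e : Fin n × Fin n => e.1 < e.2]
  congr 1
  refine (Finset.sum_subset ?_ ?_).symm
  · intro e he
    simp only [Finset.mem_filter, Finset.mem_univ, true_and] at he ⊢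
    exact not_lt.2 he.le
  · intro e he he'
    simp only [Finset.mem_filter, Finset.mem_univ, true_and] at he he'
    rw [le_antisymm (not_lt.1 he') (not_lt.1 he), hf]

open Classical in
/-- A product over the edges factorises when summed over all graphs. -/
lemma sum_graph_prod {n : ℕ} (a b : Fin n × Fin n → ℝ) :
    ∑ γ : SimpleGraph (Fin n), ∏ e ∈ edgePairs n, (if γ.Adj e.1 e.2 then a e else b e) =
      ∏ e ∈ edgePairs n, (a e + b e) := by
  rw [Finset.prod_add]
  refine Finset.sum_bij' (fun γ _ => (edgePairs n).filter fun e => γ.Adj e.1 e.2)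
    (fun s _ => SimpleGraph.fromRel fun i j => i < j ∧ (i, j) ∈ s) ?_ ?_ ?_ ?_ ?_
  · intro γ _
    exact Finset.mem_powerset.2 (Finset.filter_subset _ _)
  · intro s _
    exact Finset.mem_univ _
  · intro γ _
    ext i j
    simp only [SimpleGraph.fromRel_adj, edgePairs, Finset.mem_filter, Finset.mem_univ, true_and]
    constructor
    · rintro ⟨-, ⟨-, -, h⟩ | ⟨-, -, h⟩⟩
      exacts [h, h.symm]
    · intro h
      refine ⟨h.ne, ?_⟩
      rcases lt_or_gt_of_ne h.ne with hij | hij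
      exacts [.inl ⟨hij, hij, h⟩, .inr ⟨hij, hij, h.symm⟩]
  · intro s hs
    rw [Finset.mem_powerset] at hs
    ext ⟨i, j⟩
    simp only [SimpleGraph.fromRel_adj, Finset.mem_filter]
    constructor
    · rintro ⟨h, -, ⟨-, h'⟩ | ⟨h', -⟩⟩
      · exact h'
      · simp only [edgePairs, Finset.mem_filter] at h
        exact absurd h.2 h'.asymm
    · intro h
      have h' : i < j := (Finset.mem_filter.1 (hs h)).2
      exact ⟨hs h, h'.ne, .inl ⟨h', h⟩⟩
  · intro γ _
    rw [Finset.prod_ite]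
    congr 2
    ext e
    simp only [Finset.mem_filter, Finset.mem_sdiff]
    tauto

open Classical in
/-- The probability of the graph `γ` if the edges `ij` are present independently with probabilities
`p i j`. -/
noncomputable def graphWeight {n : ℕ} (p : Fin n → Fin n → ℝ) (γ : SimpleGraph (Fin n)) : ℝ :=
  ∏ e ∈ edgePairs n, if γ.Adj e.1 e.2 then p e.1 e.2 else 1 - p e.1 e.2

open Classical in
/-- The centred adjacency matrix, with zero diagonal. -/
noncomputable def edgeDeviation {n : ℕ} (p : Fin n → Fin n → ℝ) (γ : SimpleGraph (Fin n))
    (i j : Fin n) : ℝ :=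
  if i = j then 0 else (if γ.Adj i j then 1 else 0) - p i j

lemma edgeDeviation_congr {n : ℕ} {p p' : Fin n → Fin n → ℝ} (h : ∀ i j, i ≠ j → p i j = p' i j)
    (γ : SimpleGraph (Fin n)) : edgeDeviation p γ = edgeDeviation p' γ := by
  ext i j
  rcases eq_or_ne i j with rfl | hij
  · simp [edgeDeviation]
  · simp [edgeDeviation, hij, h i j hij]

lemma measurableSet_cutNormLE_edgeDeviation {Ω : Type*} {n : ℕ} [MeasurableSpace Ω]
    {p : Ω → Fin n → Fin n → ℝ} (hp : ∀ i j, Measurable fun ω => p ω i j)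
    (γ : SimpleGraph (Fin n)) (c : ℝ) :
    MeasurableSet {ω | CutNormLE (edgeDeviation (p ω) γ) c} := by
  have hset : {ω | CutNormLE (edgeDeviation (p ω) γ) c} =
      ⋂ S : Finset (Fin n), ⋂ S' : Finset (Fin n),
        {ω | |∑ i ∈ S, ∑ j ∈ S', edgeDeviation (p ω) γ i j| ≤ c} := by
    ext ω
    simp [CutNormLE]
  rw [hset]
  refine .iInter fun S => .iInter fun S' => measurableSet_le (Measurable.abs ?_) measurable_const
  refine Finset.measurable_fun_sum _ fun i _ => Finset.measurable_fun_sum _ fun j _ => ?_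
  simp only [edgeDeviation]
  split_ifs
  exacts [measurable_const, measurable_const.sub (hp i j), measurable_const.sub (hp i j)]

lemma graphWeight_nonneg {n : ℕ} {p : Fin n → Fin n → ℝ} (hp : ∀ i j, p i j ∈ Icc (0 : ℝ) 1)
    (γ : SimpleGraph (Fin n)) : 0 ≤ graphWeight p γ := by
  refine Finset.prod_nonneg fun e _ => ?_
  split_ifs
  · exact (hp _ _).1
  · exact sub_nonneg.2 (hp _ _).2

open Classical in
/-- The marginal probability of the edge `e` is `p e`. -/
lemma sum_graphWeight_of_adj {n : ℕ} (p : Fin n → Fin n → ℝ) {e : Fin n × Fin n}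
    (he : e ∈ edgePairs n) :
    ∑ γ : SimpleGraph (Fin n), (if γ.Adj e.1 e.2 then graphWeight p γ else 0) = p e.1 e.2 := by
  have h : ∀ γ : SimpleGraph (Fin n), (if γ.Adj e.1 e.2 then graphWeight p γ else 0) =
      ∏ f ∈ edgePairs n, if γ.Adj f.1 f.2 then p f.1 f.2
        else if f = e then 0 else 1 - p f.1 f.2 := by
    intro γ
    split_ifs with hγ
    · refine Finset.prod_congr rfl fun f _ => ?_
      by_cases hf : f = e
      · subst hf
        simp [hγ]
      · simp [hf]
    · refine (Finset.prod_eq_zero he ?_).symm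
      simp [hγ]
  simp only [h]
  rw [sum_graph_prod (fun f => p f.1 f.2) fun f => if f = e then 0 else 1 - p f.1 f.2,
    Finset.prod_eq_single_of_mem e he]
  · simp
  · intro f _ hf
    simp [hf]

lemma bernoulli_exp_le {p c : ℝ} (hp : p ∈ Icc (0 : ℝ) 1) (hc : |c| ≤ 1) :
    p * Real.exp (c * (1 - p)) + (1 - p) * Real.exp (c * (0 - p)) ≤ Real.exp (c ^ 2) := by
  have hexp : ∀ x : ℝ, |x| ≤ |c| → Real.exp x ≤ 1 + x + c ^ 2 := by
    intro x hx
    have h1 := Real.abs_exp_sub_one_sub_id_le (hx.trans hc)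
    have h2 : x ^ 2 ≤ c ^ 2 := sq_le_sq.2 hx
    linarith [(abs_le.1 h1).2]
  have h1 := hexp (c * (1 - p)) (by
    rw [abs_mul]
    exact mul_le_of_le_one_right (abs_nonneg _) (abs_le.2 ⟨by linarith [hp.2], by linarith [hp.1]⟩))
  have h2 := hexp (c * (0 - p)) (by
    rw [abs_mul]
    exact mul_le_of_le_one_right (abs_nonneg _) (abs_le.2 ⟨by linarith [hp.2], by linarith [hp.1]⟩))
  calc p * Real.exp (c * (1 - p)) + (1 - p) * Real.exp (c * (0 - p))
      ≤ p * (1 + c * (1 - p) + c ^ 2) + (1 - p) * (1 + c * (0 - p) + c ^ 2) :=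
        add_le_add (mul_le_mul_of_nonneg_left h1 hp.1)
          (mul_le_mul_of_nonneg_left h2 (sub_nonneg.2 hp.2))
    _ = c ^ 2 + 1 := by ring
    _ ≤ Real.exp (c ^ 2) := Real.add_one_le_exp _

lemma fst_ne_snd_of_mem_edgePairs {n : ℕ} {e : Fin n × Fin n} (he : e ∈ edgePairs n) :
    e.1 ≠ e.2 := (Finset.mem_filter.1 he).2.ne

open Classical in
lemma sum_graphWeight_exp_le {n : ℕ} {p : Fin n → Fin n → ℝ} (hp : ∀ i j, p i j ∈ Icc (0 : ℝ) 1)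
    (c : Fin n × Fin n → ℝ) (hc : ∀ e, |c e| ≤ 1) :
    ∑ γ : SimpleGraph (Fin n), graphWeight p γ *
      Real.exp (∑ e ∈ edgePairs n, c e * edgeDeviation p γ e.1 e.2) ≤
      Real.exp (∑ e ∈ edgePairs n, c e ^ 2) := by
  have h : ∀ γ : SimpleGraph (Fin n), graphWeight p γ *
      Real.exp (∑ e ∈ edgePairs n, c e * edgeDeviation p γ e.1 e.2) =
      ∏ e ∈ edgePairs n, if γ.Adj e.1 e.2 then p e.1 e.2 * Real.exp (c e * (1 - p e.1 e.2))
        else (1 - p e.1 e.2) * Real.exp (c e * (0 - p e.1 e.2)) := by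
    intro γ
    rw [Real.exp_sum, graphWeight, ← Finset.prod_mul_distrib]
    refine Finset.prod_congr rfl fun e he => ?_
    rw [edgeDeviation, if_neg (fst_ne_snd_of_mem_edgePairs he)]
    split_ifs <;> rfl
  simp only [h]
  rw [sum_graph_prod (fun e => p e.1 e.2 * Real.exp (c e * (1 - p e.1 e.2)))
    fun e => (1 - p e.1 e.2) * Real.exp (c e * (0 - p e.1 e.2)), Real.exp_sum]
  refine Finset.prod_le_prod (fun e _ => ?_) fun e _ => bernoulli_exp_le (hp _ _) (hc e)
  have h1 := (hp e.1 e.2).1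
  have h2 := sub_nonneg.2 (hp e.1 e.2).2
  positivity

lemma edgeDeviation_symm {n : ℕ} {p : Fin n → Fin n → ℝ} (hs : ∀ i j, p i j = p j i)
    (γ : SimpleGraph (Fin n)) (i j : Fin n) : edgeDeviation p γ i j = edgeDeviation p γ j i := by
  classical
  rcases eq_or_ne i j with rfl | h
  · rfl
  · rw [edgeDeviation, edgeDeviation, if_neg h, if_neg h.symm, hs i j]
    exact congrArg (· - p j i) (if_congr (γ.adj_comm i j) rfl rfl)

lemma card_edgePairs_le (n : ℕ) : ((edgePairs n).card : ℝ) ≤ (n : ℝ) ^ 2 := by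
  have h := Finset.card_le_univ (edgePairs n)
  simp only [Fintype.card_prod, Fintype.card_fin] at h
  rw [sq]
  exact_mod_cast h

open Classical in
/-- Chernoff bound for the number of edges between two sets of vertices, in either direction
`s = ±1`. -/
lemma sum_graphWeight_deviation_le {n : ℕ} {p : Fin n → Fin n → ℝ}
    (hp : ∀ i j, p i j ∈ Icc (0 : ℝ) 1) (hs : ∀ i j, p i j = p j i) {ε : ℝ} (hε : 0 < ε)
    (hε1 : ε ≤ 1) (s : ℝ) (hsgn : |s| = 1) (S S' : Finset (Fin n)) :
    ∑ γ : SimpleGraph (Fin n), (if ε * (n : ℝ) ^ 2 < s * ∑ i ∈ S, ∑ j ∈ S', edgeDeviation p γ i j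
      then graphWeight p γ else 0) ≤ Real.exp (-(ε ^ 2 * (n : ℝ) ^ 2 / 16)) := by
  -- The exponential moment with parameter `λ = ε / 8` is used, so that the coefficients
  -- `λ · {0, ±1, ±2}` have absolute value at most `1`. The exponent
  -- `∑ c² - λ ε n²` is then at most `(ε² / 16 - ε² / 8) n²`.
  set c : Fin n × Fin n → ℝ := fun e => ε / 8 * s *
    ((if e.1 ∈ S ∧ e.2 ∈ S' then 1 else 0) + if e.2 ∈ S ∧ e.1 ∈ S' then 1 else 0) with hc_def
  have hrep : ∀ γ : SimpleGraph (Fin n), ε / 8 * (s * ∑ i ∈ S, ∑ j ∈ S', edgeDeviation p γ i j) =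
      ∑ e ∈ edgePairs n, c e * edgeDeviation p γ e.1 e.2 := by
    intro γ
    have h1 : ∑ i ∈ S, ∑ j ∈ S', edgeDeviation p γ i j =
        ∑ i, ∑ j, if i ∈ S ∧ j ∈ S' then edgeDeviation p γ i j else 0 := by
      simp only [ite_and, Finset.sum_ite_irrel, Finset.sum_const_zero]
      simp [Finset.sum_ite_mem]
    rw [h1, sum_sum_eq_sum_edgePairs _ fun i => by simp [edgeDeviation], ← mul_assoc,
      Finset.mul_sum]
    refine Finset.sum_congr rfl fun e _ => ?_
    rw [edgeDeviation_symm hs γ e.2 e.1, hc_def]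
    simp only
    rw [mul_assoc (ε / 8 * s)]
    congr 1
    split_ifs <;> ring
  have hcabs : ∀ e, |c e| ≤ ε / 4 := by
    intro e
    rw [hc_def]
    simp only [abs_mul, hsgn]
    rw [abs_of_pos (by positivity : 0 < ε / 8)]
    have h2 : |(if e.1 ∈ S ∧ e.2 ∈ S' then (1 : ℝ) else 0) +
        if e.2 ∈ S ∧ e.1 ∈ S' then 1 else 0| ≤ 2 := by
      split_ifs <;> norm_num
    nlinarith
  calc _ ≤ ∑ γ : SimpleGraph (Fin n), Real.exp (-(ε / 8 * (ε * (n : ℝ) ^ 2))) *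
        (graphWeight p γ *
          Real.exp (∑ e ∈ edgePairs n, c e * edgeDeviation p γ e.1 e.2)) := by
        refine Finset.sum_le_sum fun γ _ => ?_
        have hw := graphWeight_nonneg hp γ
        split_ifs with h
        · rw [← hrep, mul_left_comm, ← Real.exp_add]
          refine le_mul_of_one_le_right hw (Real.one_le_exp ?_)
          nlinarith
        · positivity
    _ ≤ Real.exp (-(ε / 8 * (ε * (n : ℝ) ^ 2))) * Real.exp (∑ e ∈ edgePairs n, c e ^ 2) := by
        rw [← Finset.mul_sum]
        exact mul_le_mul_of_nonneg_left
          (sum_graphWeight_exp_le hp c fun e => (hcabs e).trans (by linarith)) (Real.exp_nonneg _)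
    _ ≤ _ := by
        rw [← Real.exp_add]
        refine Real.exp_le_exp.2 ?_
        have h1 : ∑ e ∈ edgePairs n, c e ^ 2 ≤ (n : ℝ) ^ 2 * (ε / 4) ^ 2 := by
          calc ∑ e ∈ edgePairs n, c e ^ 2 ≤ ∑ _e ∈ edgePairs n, (ε / 4) ^ 2 :=
                Finset.sum_le_sum fun e _ => by
                  rw [← sq_abs]
                  exact pow_le_pow_left₀ (abs_nonneg _) (hcabs e) 2
            _ ≤ _ := by
                rw [Finset.sum_const, nsmul_eq_mul]
                exact mul_le_mul_of_nonneg_right (card_edgePairs_le n) (sq_nonneg _)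
        nlinarith

open Classical in
/-- Concentration in cut norm of a graph with independent edges: a union bound over all pairs of
vertex sets. -/
lemma sum_graphWeight_not_cutNormLE_le {n : ℕ} {p : Fin n → Fin n → ℝ}
    (hp : ∀ i j, p i j ∈ Icc (0 : ℝ) 1) (hs : ∀ i j, p i j = p j i) {ε : ℝ} (hε : 0 < ε)
    (hε1 : ε ≤ 1) :
    ∑ γ : SimpleGraph (Fin n), (if CutNormLE (edgeDeviation p γ) (ε * (n : ℝ) ^ 2) then 0
      else graphWeight p γ) ≤ 2 * 4 ^ n * Real.exp (-(ε ^ 2 * (n : ℝ) ^ 2 / 16)) := by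
  have hterm : ∀ γ : SimpleGraph (Fin n),
      (if CutNormLE (edgeDeviation p γ) (ε * (n : ℝ) ^ 2) then 0 else graphWeight p γ) ≤
      ∑ q : Finset (Fin n) × Finset (Fin n),
        ((if ε * (n : ℝ) ^ 2 < 1 * ∑ i ∈ q.1, ∑ j ∈ q.2, edgeDeviation p γ i j
          then graphWeight p γ else 0) +
        if ε * (n : ℝ) ^ 2 < -1 * ∑ i ∈ q.1, ∑ j ∈ q.2, edgeDeviation p γ i j
          then graphWeight p γ else 0) := by
    intro γ
    have hw := graphWeight_nonneg hp γ
    have hnn : ∀ q : Finset (Fin n) × Finset (Fin n), 0 ≤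
        ((if ε * (n : ℝ) ^ 2 < 1 * ∑ i ∈ q.1, ∑ j ∈ q.2, edgeDeviation p γ i j
          then graphWeight p γ else 0) +
        if ε * (n : ℝ) ^ 2 < -1 * ∑ i ∈ q.1, ∑ j ∈ q.2, edgeDeviation p γ i j
          then graphWeight p γ else 0) := by
      intro q
      split_ifs <;> linarith
    split_ifs with h
    · exact Finset.sum_nonneg fun q _ => hnn q
    · simp only [CutNormLE, not_forall, not_le] at h
      obtain ⟨S, S', h⟩ := h
      refine le_trans ?_ (Finset.single_le_sum (fun q _ => hnn q) (Finset.mem_univ (S, S')))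
      rcases lt_abs.1 h with h | h
      · rw [if_pos (by simpa using h)]
        split_ifs <;> linarith
      · rw [if_pos (c := ε * (n : ℝ) ^ 2 < -1 * _) (by simpa using h)]
        split_ifs <;> linarith
  refine (Finset.sum_le_sum fun γ _ => hterm γ).trans ?_
  rw [Finset.sum_comm]
  calc _ ≤ ∑ _q : Finset (Fin n) × Finset (Fin n),
        2 * Real.exp (-(ε ^ 2 * (n : ℝ) ^ 2 / 16)) := by
        refine Finset.sum_le_sum fun q _ => ?_
        rw [Finset.sum_add_distrib, two_mul]
        exact add_le_add (sum_graphWeight_deviation_le hp hs hε hε1 1 (by simp) q.1 q.2)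
          (sum_graphWeight_deviation_le hp hs hε hε1 (-1) (by simp) q.1 q.2)
    _ = _ := by
        rw [Finset.sum_const, nsmul_eq_mul, Finset.card_univ, Fintype.card_prod,
          Fintype.card_finset, Fintype.card_fin]
        push_cast
        rw [← mul_pow]
        norm_num
        ring

/-! ### Conditioning on the types -/

namespace GraphProcess

variable {T : ℝ} {H : EdgeProbability T} {n : ℕ+} {Ω : Type*} [MeasurableSpace Ω] {P : Measure Ω}

/-- The `σ`-algebra generated by all types at all times. -/
abbrev typeSigma (𝒢 : GraphProcess H n P) : MeasurableSpace Ω :=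
  ⨆ i, ⨆ s, MeasurableSpace.comap (𝒢.X i s) inferInstance

/-- The conditional probability of the edge `ij` at time `t`. -/
noncomputable def prob (𝒢 : GraphProcess H n P) (t : TimeInterval T) (ω : Ω) (i j : Fin n) : ℝ :=
  H t (𝒢.X i t ω) (𝒢.X j t ω) (𝒢.F ω)

variable (𝒢 : GraphProcess H n P)

lemma typeSigma_le : 𝒢.typeSigma ≤ ‹MeasurableSpace Ω› :=
  iSup_le fun i => iSup_le fun s => (𝒢.measurable_X i s).comap_le

lemma prob_mem (t : TimeInterval T) (ω : Ω) (i j : Fin n) : 𝒢.prob t ω i j ∈ Icc (0 : ℝ) 1 :=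
  (H t (𝒢.X i t ω) (𝒢.X j t ω) (𝒢.F ω)).2

lemma prob_symm (t : TimeInterval T) (ω : Ω) (i j : Fin n) :
    𝒢.prob t ω i j = 𝒢.prob t ω j i := by
  rw [prob, H.symm, prob]

/-- The event that the edge `ij` is present at time `t`. -/
def adjSet (t : TimeInterval T) (i j : Fin n) : Set Ω := {ω | (𝒢.G t ω).Adj i j}

lemma measurableSet_graph_eq (t : TimeInterval T) (γ : SimpleGraph (Fin n)) :
    MeasurableSet {ω | 𝒢.G t ω = γ} := by
  have h : {ω | 𝒢.G t ω = γ} = ⋂ i, ⋂ j, {ω | (𝒢.G t ω).Adj i j ↔ γ.Adj i j} := by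
    ext ω
    simp only [mem_ofPred_eq, mem_iInter, SimpleGraph.ext_iff, funext_iff, eq_iff_iff]
  rw [h]
  refine .iInter fun i => .iInter fun j => ?_
  by_cases hγ : γ.Adj i j
  · simpa [hγ] using 𝒢.measurable_G t i j
  · have h' : {ω | (𝒢.G t ω).Adj i j ↔ γ.Adj i j} = {ω | (𝒢.G t ω).Adj i j}ᶜ := by
      ext ω
      simp [hγ]
    rw [h']
    exact (𝒢.measurable_G t i j).compl

lemma condExp_graph (t : TimeInterval T) (γ : SimpleGraph (Fin n)) :
    P[({ω | 𝒢.G t ω = γ}).indicator (fun _ => (1 : ℝ)) | 𝒢.typeSigma] =ᵐ[P]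
      fun ω => graphWeight (𝒢.prob t ω) γ :=
  𝒢.condLaw t γ

variable [IsProbabilityMeasure P]

lemma integrable_indicator_one {s : Set Ω} (hs : MeasurableSet s) :
    Integrable (s.indicator fun _ => (1 : ℝ)) P :=
  (integrable_const (1 : ℝ)).indicator hs

/-- The conditional probability of an edge is as prescribed. -/
lemma condExp_adjSet (t : TimeInterval T) {i j : Fin n} (hij : i ≠ j) :
    P[(𝒢.adjSet t i j).indicator (fun _ => (1 : ℝ)) | 𝒢.typeSigma] =ᵐ[P]
      fun ω => 𝒢.prob t ω i j := by
  classical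
  wlog hlt : i < j generalizing i j
  · have h := this hij.symm (lt_of_le_of_ne (not_lt.1 hlt) hij.symm)
    have hset : 𝒢.adjSet t j i = 𝒢.adjSet t i j :=
      Set.ext fun ω => (𝒢.G t ω).adj_comm j i
    rw [hset] at h
    filter_upwards [h] with ω hω
    rw [hω, 𝒢.prob_symm]
  have hsum : (𝒢.adjSet t i j).indicator (fun _ => (1 : ℝ)) =
      ∑ γ ∈ Finset.univ.filter fun γ : SimpleGraph (Fin n) => γ.Adj i j,
        ({ω | 𝒢.G t ω = γ}).indicator fun _ => (1 : ℝ) := by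
    ext ω
    simp [indicator_apply, adjSet]
  rw [hsum]
  have hall : ∀ᵐ ω ∂P, ∀ γ, (P[({ω | 𝒢.G t ω = γ}).indicator (fun _ => (1 : ℝ)) | 𝒢.typeSigma]) ω =
      graphWeight (𝒢.prob t ω) γ := ae_all_iff.2 fun γ => 𝒢.condExp_graph t γ
  filter_upwards [condExp_finsetSum (μ := P) (fun γ _ => integrable_indicator_one
    (𝒢.measurableSet_graph_eq t γ)) 𝒢.typeSigma, hall] with ω h1 h2
  rw [h1, Finset.sum_apply, Finset.sum_congr rfl fun γ _ => h2 γ, Finset.sum_filter]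
  exact sum_graphWeight_of_adj (𝒢.prob t ω) (e := (i, j))
    (Finset.mem_filter.2 ⟨Finset.mem_univ _, hlt⟩)

/-- At a fixed time the graph is close in cut norm to its conditional expectation. -/
lemma measure_not_cutNormLE_le (t : TimeInterval T) {ε : ℝ} (hε : 0 < ε) (hε1 : ε ≤ 1) :
    P {ω | ¬ CutNormLE (edgeDeviation (𝒢.prob t ω) (𝒢.G t ω)) (ε * (n : ℝ) ^ 2)} ≤
      ENNReal.ofReal (2 * 4 ^ (n : ℕ) * Real.exp (-(ε ^ 2 * (n : ℝ) ^ 2 / 16))) := by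
  classical
  -- The prescribed probabilities need not be measurable functions of the types. The conditional
  -- expectations are, and agree with them almost everywhere.
  set p' : Ω → Fin n → Fin n → ℝ := fun ω i j =>
    (P[(𝒢.adjSet t i j).indicator (fun _ => (1 : ℝ)) | 𝒢.typeSigma]) ω with hp'
  have hpp' : ∀ᵐ ω ∂P, ∀ i j, i ≠ j → p' ω i j = 𝒢.prob t ω i j :=
    ae_all_iff.2 fun i => ae_all_iff.2 fun j => by
      by_cases hij : i = j
      · simp [hij]
      · filter_upwards [𝒢.condExp_adjSet t hij] with ω hω _ using hω
  have hmeas' : ∀ i j, Measurable[𝒢.typeSigma] fun ω => p' ω i j := fun i j =>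
    stronglyMeasurable_condExp.measurable
  set Q : SimpleGraph (Fin n) → Set Ω := fun γ =>
    {ω | ¬ CutNormLE (edgeDeviation (p' ω) γ) (ε * (n : ℝ) ^ 2)} with hQ
  have hQmeas : ∀ γ, MeasurableSet[𝒢.typeSigma] (Q γ) := by
    intro γ
    exact MeasurableSet.compl
      (@measurableSet_cutNormLE_edgeDeviation _ _ 𝒢.typeSigma _ hmeas' γ _)
  have hsub : {ω | ¬ CutNormLE (edgeDeviation (𝒢.prob t ω) (𝒢.G t ω)) (ε * (n : ℝ) ^ 2)} ≤ᵐ[P]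
      ⋃ γ, ({ω | 𝒢.G t ω = γ} ∩ Q γ : Set Ω) := by
    filter_upwards [hpp'] with ω hω hbad
    refine mem_iUnion.2 ⟨𝒢.G t ω, rfl, ?_⟩
    simp only [hQ, mem_ofPred_eq]
    rw [edgeDeviation_congr hω]
    exact hbad
  have hind : ∀ γ, (Q γ).indicator
      (P[({ω | 𝒢.G t ω = γ}).indicator (fun _ => (1 : ℝ)) | 𝒢.typeSigma]) =ᵐ[P]
      fun ω => if CutNormLE (edgeDeviation (𝒢.prob t ω) γ) (ε * (n : ℝ) ^ 2) then 0
        else graphWeight (𝒢.prob t ω) γ := by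
    intro γ
    filter_upwards [hpp', 𝒢.condExp_graph t γ] with ω h1 h2
    have hmem : ω ∈ Q γ ↔ ¬ CutNormLE (edgeDeviation (𝒢.prob t ω) γ) (ε * (n : ℝ) ^ 2) := by
      rw [← edgeDeviation_congr h1]
      rfl
    by_cases hω : ω ∈ Q γ
    · rw [indicator_of_mem hω, h2, if_neg (hmem.1 hω)]
    · rw [indicator_of_notMem hω, if_pos (not_not.1 (mt hmem.2 hω))]
  have hint : ∀ γ, P.real ({ω | 𝒢.G t ω = γ} ∩ Q γ) =
      ∫ ω, (if CutNormLE (edgeDeviation (𝒢.prob t ω) γ) (ε * (n : ℝ) ^ 2) then 0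
        else graphWeight (𝒢.prob t ω) γ) ∂P := by
    intro γ
    have hQm : MeasurableSet (Q γ) := 𝒢.typeSigma_le _ (hQmeas γ)
    calc P.real ({ω | 𝒢.G t ω = γ} ∩ Q γ)
        = ∫ ω in Q γ, ({ω | 𝒢.G t ω = γ}).indicator (fun _ => (1 : ℝ)) ω ∂P := by
          rw [integral_indicator (𝒢.measurableSet_graph_eq t γ), setIntegral_const, smul_eq_mul,
            mul_one, measureReal_restrict_apply (𝒢.measurableSet_graph_eq t γ)]
      _ = ∫ ω in Q γ, (P[({ω | 𝒢.G t ω = γ}).indicator (fun _ => (1 : ℝ)) | 𝒢.typeSigma]) ω ∂P :=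
          (setIntegral_condExp 𝒢.typeSigma_le
            (integrable_indicator_one (𝒢.measurableSet_graph_eq t γ)) (hQmeas γ)).symm
      _ = _ := by
          rw [← integral_indicator hQm]
          exact integral_congr_ae (hind γ)
  have hfint : ∀ γ, Integrable (fun ω => if CutNormLE (edgeDeviation (𝒢.prob t ω) γ)
      (ε * (n : ℝ) ^ 2) then 0 else graphWeight (𝒢.prob t ω) γ) P := by
    intro γ
    refine ((integrable_condExp (m := 𝒢.typeSigma) (μ := P)
      (f := ({ω | 𝒢.G t ω = γ}).indicator fun _ => (1 : ℝ))).indicator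
        (𝒢.typeSigma_le _ (hQmeas γ))).congr (hind γ)
  refine (measure_mono_ae hsub).trans ((measure_iUnion_fintype_le _ _).trans ?_)
  calc ∑ γ, P ({ω | 𝒢.G t ω = γ} ∩ Q γ)
      = ENNReal.ofReal (∑ γ, P.real ({ω | 𝒢.G t ω = γ} ∩ Q γ)) := by
        rw [ENNReal.ofReal_sum_of_nonneg fun _ _ => measureReal_nonneg]
        exact Finset.sum_congr rfl fun γ _ => (ofReal_measureReal (measure_ne_top _ _)).symm
    _ ≤ _ := by
        refine ENNReal.ofReal_le_ofReal ?_
        simp only [hint]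
        rw [← integral_finsetSum _ fun γ _ => hfint γ]
        calc _ ≤ ∫ _, 2 * 4 ^ (n : ℕ) * Real.exp (-(ε ^ 2 * (n : ℝ) ^ 2 / 16)) ∂P :=
              integral_mono (integrable_finsetSum _ fun γ _ => hfint γ) (integrable_const _)
                fun ω => by
                  convert sum_graphWeight_not_cutNormLE_le (𝒢.prob_mem t ω) (𝒢.prob_symm t ω)
                    hε hε1
          _ = _ := by simp

/-- If the edge `ij` can differ at times `t` and `u` only on the event `B`, then its conditional
probabilities at these times differ at most by the conditional probability of `B`. -/
lemma abs_prob_sub_prob_le (t u : TimeInterval T) {i j : Fin n} (hij : i ≠ j) {B : Set Ω}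
    (hB : MeasurableSet B) (h : ∀ ω, ¬((𝒢.G t ω).Adj i j ↔ (𝒢.G u ω).Adj i j) → ω ∈ B) :
    ∀ᵐ ω ∂P, |𝒢.prob u ω i j - 𝒢.prob t ω i j| ≤
      (P[B.indicator (fun _ => (1 : ℝ)) | 𝒢.typeSigma]) ω := by
  classical
  have key : ∀ t u : TimeInterval T,
      (∀ ω, ¬((𝒢.G t ω).Adj i j ↔ (𝒢.G u ω).Adj i j) → ω ∈ B) →
      ∀ᵐ ω ∂P, 𝒢.prob u ω i j - 𝒢.prob t ω i j ≤
        (P[B.indicator (fun _ => (1 : ℝ)) | 𝒢.typeSigma]) ω := by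
    intro t u h
    have hi := fun s => integrable_indicator_one (P := P) (s := 𝒢.adjSet s i j)
      (𝒢.measurable_G s i j)
    have hmono := condExp_mono (m := 𝒢.typeSigma) ((hi u).sub (hi t))
      (integrable_indicator_one hB) (ae_of_all P fun ω => by
        simp only [Pi.sub_apply, indicator_apply, adjSet, mem_ofPred_eq]
        by_cases hω : ω ∈ B
        · simp only [hω]
          split_ifs <;> norm_num
        · simp [not_not.1 (mt (h ω) hω), hω])
    filter_upwards [hmono, condExp_sub (hi u) (hi t) 𝒢.typeSigma, 𝒢.condExp_adjSet t hij,
      𝒢.condExp_adjSet u hij] with ω h1 h2 h3 h4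
    rw [h2, Pi.sub_apply, h3, h4] at h1
    exact h1
  filter_upwards [key t u h, key u t fun ω hω => h ω fun h' => hω h'.symm] with ω h1 h2
  exact abs_le.2 ⟨by linarith, h1⟩

end GraphProcess

/-- If the expected number of events that happen, given a `σ`-algebra, exceeds `2ηK`, where `K` is
the number of events, then the conditional probability that more than `ηK` of them happen exceeds `η`;
the bound is then Markov's inequality. -/
lemma measure_sum_condExp_gt_le {Ω ι : Type*} {m m0 : MeasurableSpace Ω} {P : Measure Ω}
    [IsProbabilityMeasure P] (hm : m ≤ m0) (s : Finset ι) (B : ι → Set Ω)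
    (hB : ∀ i, MeasurableSet (B i)) {η : ℝ} (hη : 0 < η) :
    P {ω | 2 * η * s.card < ∑ i ∈ s, (P[(B i).indicator (fun _ => (1 : ℝ)) | m]) ω} ≤
      ENNReal.ofReal η⁻¹ *
        P {ω | η * s.card < ∑ i ∈ s, (B i).indicator (fun _ => (1 : ℝ)) ω} := by
  set N : Ω → ℝ := fun ω => ∑ i ∈ s, (B i).indicator (fun _ => (1 : ℝ)) ω with hN
  set A : Set Ω := {ω | η * s.card < N ω} with hA
  have hNmeas : Measurable N :=
    Finset.measurable_fun_sum _ fun i _ => measurable_const.indicator (hB i)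
  have hAmeas : MeasurableSet A := measurableSet_lt measurable_const hNmeas
  have hi : ∀ {C : Set Ω}, MeasurableSet C → Integrable (C.indicator fun _ => (1 : ℝ)) P :=
    fun hC => (integrable_const (1 : ℝ)).indicator hC
  set Q : Ω → ℝ := P[A.indicator (fun _ => (1 : ℝ)) | m] with hQ
  have hle : (∑ i ∈ s, (B i).indicator fun _ => (1 : ℝ)) ≤ᵐ[P]
      (fun _ => η * s.card) + (s.card : ℝ) • A.indicator fun _ => (1 : ℝ) := by
    refine ae_of_all _ fun ω => ?_
    rw [Finset.sum_apply]
    change N ω ≤ η * s.card + (s.card : ℝ) * A.indicator (fun _ => (1 : ℝ)) ω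
    by_cases hω : ω ∈ A
    · rw [indicator_of_mem hω, mul_one]
      have h1 : N ω ≤ s.card := by
        refine (Finset.sum_le_card_nsmul s _ 1 fun i _ => ?_).trans_eq (by simp)
        exact indicator_apply_le' (fun _ => le_rfl) fun _ => zero_le_one
      have : 0 ≤ η * s.card := by positivity
      linarith
    · rw [indicator_of_notMem hω, mul_zero, add_zero]
      exact not_lt.1 hω
  have hmono := condExp_mono (m := m) (integrable_finsetSum' s fun i _ => hi (hB i))
    ((integrable_const _).add ((hi hAmeas).smul (s.card : ℝ))) hle
  have hsub : ∀ᵐ ω ∂P, 2 * η * s.card < ∑ i ∈ s, (P[(B i).indicator (fun _ => (1 : ℝ)) | m]) ω →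
      η ≤ Q ω := by
    filter_upwards [hmono, condExp_finsetSum (fun i _ => hi (hB i)) m,
      condExp_add (integrable_const (η * (s.card : ℝ))) ((hi hAmeas).smul (s.card : ℝ)) m,
      condExp_smul (μ := P) (s.card : ℝ) (A.indicator fun _ => (1 : ℝ)) m] with ω h1 h2 h3 h4 h5
    rw [h2, Finset.sum_apply, h3, Pi.add_apply, h4, condExp_const hm, Pi.smul_apply,
      smul_eq_mul] at h1
    have h6 : (s.card : ℝ) * η < s.card * Q ω := by linarith
    exact (lt_of_mul_lt_mul_left h6 (Nat.cast_nonneg _)).le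
  have hQnn : 0 ≤ᵐ[P] Q := condExp_nonneg (ae_of_all _ fun ω => indicator_nonneg (by simp) ω)
  have hmarkov := mul_meas_ge_le_integral_of_nonneg hQnn integrable_condExp η
  rw [integral_condExp hm, integral_indicator hAmeas, setIntegral_const, smul_eq_mul, mul_one]
    at hmarkov
  calc P {ω | 2 * η * s.card < ∑ i ∈ s, (P[(B i).indicator (fun _ => (1 : ℝ)) | m]) ω}
      ≤ P {ω | η ≤ Q ω} := measure_mono_ae hsub
    _ = ENNReal.ofReal (P.real {ω | η ≤ Q ω}) := (ofReal_measureReal (measure_ne_top _ _)).symm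
    _ ≤ ENNReal.ofReal (η⁻¹ * P.real A) := by
        refine ENNReal.ofReal_le_ofReal ?_
        rwa [← div_eq_inv_mul, le_div_iff₀' hη]
    _ = _ := by
        rw [ENNReal.ofReal_mul (by positivity), ofReal_measureReal (measure_ne_top _ _)]

/-! ### Uniform closeness of the empirical graphon and the reference graphon -/

lemma card_edgePairs (n : ℕ) : ((edgePairs n).card : ℝ) = (n.choose 2 : ℝ) := by
  have h := sum_sum_eq_sum_edgePairs (n := n) (fun i j => if i = j then 0 else 1) (by simp)
  have h1 : ∀ i : Fin n, ∑ j : Fin n, (if i = j then (0 : ℝ) else 1) = n - 1 := by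
    intro i
    have h2 : ∀ j, (if i = j then (0 : ℝ) else 1) = 1 - if i = j then 1 else 0 := fun j => by
      split_ifs <;> norm_num
    simp [h2]
  have h3 : ∀ e ∈ edgePairs n, ((if e.1 = e.2 then (0 : ℝ) else 1) +
      if e.2 = e.1 then (0 : ℝ) else 1) = 2 := fun e he => by
    rw [if_neg (fst_ne_snd_of_mem_edgePairs he), if_neg (fst_ne_snd_of_mem_edgePairs he).symm]
    norm_num
  rw [Finset.sum_congr rfl h3] at h
  simp only [h1, Finset.sum_const, Finset.card_univ, Fintype.card_fin, nsmul_eq_mul] at h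
  rw [Nat.cast_choose_two]
  linarith

open Classical in
/-- Comparison of the adjacency matrix of `γ` with the edge probabilities `p` through another graph
`γ₀` with edge probabilities `p₀`. The summand `n` accounts for the diagonal. -/
lemma cutNormLE_adj_sub {n : ℕ} {γ γ₀ : SimpleGraph (Fin n)} {p p₀ : Fin n → Fin n → ℝ}
    (hp : ∀ i j, p i j ∈ Icc (0 : ℝ) 1) (hs : ∀ i j, p i j = p j i)
    (hs₀ : ∀ i j, p₀ i j = p₀ j i) {a N M : ℝ} (ha : CutNormLE (edgeDeviation p₀ γ₀) a)
    (hN : ∑ e ∈ edgePairs n, |(if γ.Adj e.1 e.2 then (1 : ℝ) else 0) -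
      if γ₀.Adj e.1 e.2 then 1 else 0| ≤ N)
    (hM : ∑ e ∈ edgePairs n, |p e.1 e.2 - p₀ e.1 e.2| ≤ M) :
    CutNormLE (fun i j => (if γ.Adj i j then 1 else 0) - p i j) (a + (n + 2 * (N + M))) := by
  set r : Fin n → Fin n → ℝ := fun i j => if i = j then 0 else
    |(if γ.Adj i j then (1 : ℝ) else 0) - if γ₀.Adj i j then 1 else 0| + |p i j - p₀ i j| with hr
  have hrsum : ∑ i, ∑ j, r i j ≤ 2 * (N + M) := by
    rw [sum_sum_eq_sum_edgePairs r fun i => by simp [hr]]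
    calc ∑ e ∈ edgePairs n, (r e.1 e.2 + r e.2 e.1)
        = ∑ e ∈ edgePairs n, 2 * (|(if γ.Adj e.1 e.2 then (1 : ℝ) else 0) -
            if γ₀.Adj e.1 e.2 then 1 else 0| + |p e.1 e.2 - p₀ e.1 e.2|) := by
          refine Finset.sum_congr rfl fun e he => ?_
          have h := fst_ne_snd_of_mem_edgePairs he
          simp only [hr, if_neg h, if_neg h.symm, hs e.2 e.1, hs₀ e.2 e.1,
            γ.adj_comm e.2 e.1, γ₀.adj_comm e.2 e.1]
          ring
      _ ≤ 2 * (N + M) := by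
          rw [← Finset.mul_sum, Finset.sum_add_distrib]
          linarith
  have hR : CutNormLE (fun i j => ((if γ.Adj i j then 1 else 0) - p i j) -
      edgeDeviation p₀ γ₀ i j) (n + 2 * (N + M)) := by
    refine CutNormLE.of_sum_abs_le ?_
    calc _ ≤ ∑ i, ∑ j, ((if i = j then 1 else 0) + r i j) := by
          refine Finset.sum_le_sum fun i _ => Finset.sum_le_sum fun j _ => ?_
          rcases eq_or_ne i j with rfl | hij
          · simp only [hr, edgeDeviation, SimpleGraph.irrefl, if_false, if_true, zero_sub, sub_zero,
              add_zero, abs_neg]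
            exact abs_le.2 ⟨by linarith [(hp i i).1], (hp i i).2⟩
          · simp only [hr, edgeDeviation, if_neg hij, zero_add]
            refine le_trans (le_of_eq ?_) (abs_sub _ _)
            congr 1
            ring
      _ ≤ n + 2 * (N + M) := by
          simp only [Finset.sum_add_distrib, Finset.sum_ite_eq, Finset.mem_univ, if_true,
            Finset.sum_const, Finset.card_univ, Fintype.card_fin, nsmul_eq_mul, mul_one]
          linarith
  simpa using ha.add hR

namespace GraphProcess

variable {T : ℝ} {H : EdgeProbability T} {n : ℕ+} {Ω : Type*} [MeasurableSpace Ω] {P : Measure Ω}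
  (𝒢 : GraphProcess H n P)

/-- The event that the edge `e` has, at some time in `D ∩ [t, t + δ]`, a state that differs from the
one at time `t`. -/
def changeSet (D : Set (TimeInterval T)) (t : TimeInterval T) (δ : ℝ) (e : Fin n × Fin n) : Set Ω :=
  ⋃ u ∈ {u ∈ D | t ≤ u ∧ (u : ℝ) ≤ t + δ},
    {ω | ¬((𝒢.G t ω).Adj e.1 e.2 ↔ (𝒢.G u ω).Adj e.1 e.2)}

lemma mem_changeSet_iff {D : Set (TimeInterval T)} {t : TimeInterval T} {δ : ℝ}
    {e : Fin n × Fin n} {ω : Ω} : ω ∈ 𝒢.changeSet D t δ e ↔ ∃ u ∈ D, t ≤ u ∧ (u : ℝ) ≤ t + δ ∧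
      ¬((𝒢.G t ω).Adj e.1 e.2 ↔ (𝒢.G u ω).Adj e.1 e.2) := by
  simp only [changeSet, mem_iUnion, mem_ofPred_eq, exists_prop, and_assoc]

lemma measurableSet_changeSet {D : Set (TimeInterval T)} (hD : D.Countable) (t : TimeInterval T)
    (δ : ℝ) (e : Fin n × Fin n) : MeasurableSet (𝒢.changeSet D t δ e) :=
  MeasurableSet.biUnion (hD.mono fun _ h => h.1) fun u _ =>
    ((𝒢.measurable_G t e.1 e.2).iff (𝒢.measurable_G u e.1 e.2)).compl

/-- The number of edges that change at times in `D` is at most `C_n(t, δ)`. -/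
lemma sum_indicator_changeSet_le_C (D : Set (TimeInterval T)) (t : TimeInterval T) (δ : ℝ)
    (ω : Ω) :
    ∑ e ∈ edgePairs n, (𝒢.changeSet D t δ e).indicator (fun _ => (1 : ℝ)) ω ≤ 𝒢.C t δ ω := by
  refine Finset.sum_le_sum fun e _ => indicator_apply_le' (fun h => ?_) fun _ =>
    Real.iSup_nonneg fun _ => abs_nonneg _
  obtain ⟨u, -, htu, huδ, hu⟩ := 𝒢.mem_changeSet_iff.1 h
  refine le_trans ?_ (le_ciSup (f := fun q : {q : TimeInterval T × TimeInterval T //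
    t ≤ q.1 ∧ q.1 ≤ q.2 ∧ (q.2 : ℝ) ≤ t + δ} =>
      |𝒢.E e.1 e.2 q.1.1 ω - 𝒢.E e.1 e.2 q.1.2 ω|) ?_ ⟨(t, u), le_rfl, htu, huδ⟩)
  · simp only [E]
    by_cases h1 : (𝒢.G t ω).Adj e.1 e.2 <;> by_cases h2 : (𝒢.G u ω).Adj e.1 e.2 <;> simp_all
  · refine ⟨1, ?_⟩
    rintro _ ⟨q, rfl⟩
    simp only [E]
    split_ifs <;> norm_num

/-- On the event described by the hypotheses, the comparison at time `t` carries over to any later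
time `u`: the cut norm does not depend on the labelling, so the labels at time `u` can be used for
the graph and the types at time `t`. -/
lemma dist_h_cutPath_le (hH : H.IsContinuous) (hord : 𝒢.OrderedLabels) (t u : TimeInterval T)
    (ω : Ω) {a N M : ℝ} (ha : CutNormLE (edgeDeviation (𝒢.prob t ω) (𝒢.G t ω)) a)
    (hN : open Classical in
      ∑ e ∈ edgePairs n, |(if (𝒢.G u ω).Adj e.1 e.2 then (1 : ℝ) else 0) -
        if (𝒢.G t ω).Adj e.1 e.2 then 1 else 0| ≤ N)
    (hM : ∑ e ∈ edgePairs n, |𝒢.prob u ω e.1 e.2 - 𝒢.prob t ω e.1 e.2| ≤ M) :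
    dist (𝒢.h ω u) (hH.cutPath (𝒢.F ω) u) ≤ (a + (n + 2 * (N + M))) / (n : ℝ) ^ 2 := by
  classical
  rw [𝒢.h_apply]
  change cutDist (empiricalGraphon ((𝒢.G u ω).comap (𝒢.label u ω))) (H.refGraphon (𝒢.F ω) u) ≤ _
  refine cutDist_le_of_cutNormLE ?_
    ((cutNormLE_adj_sub (𝒢.prob_mem u ω) (𝒢.prob_symm u ω) (𝒢.prob_symm t ω) ha hN hM).comp_perm
      (𝒢.label u ω))
  filter_upwards [ae_empiricalGraphon ((𝒢.G u ω).comap (𝒢.label u ω)),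
    ae_refGraphon H (𝒢.F ω) u _ (𝒢.F_apply ω u) (𝒢.label u ω) (hord u ω)] with q h1 h2 i j hi hj
  rw [h1 i j hi hj, h2 i j hi hj]
  simp only [SimpleGraph.comap_adj]
  rfl

variable [IsProbabilityMeasure P]

/-- The `k`-th point of the grid of width `δ`, truncated at `T`. -/
noncomputable def gridPoint (hT : 0 ≤ T) (δ : ℝ) (k : ℕ) : TimeInterval T := projIcc 0 T hT (k * δ)

lemma exists_gridPoint (hT : 0 ≤ T) {δ : ℝ} (hδ : 0 < δ) (u : TimeInterval T) :
    ∃ k ∈ Finset.range (⌊T / δ⌋₊ + 1),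
      gridPoint hT δ k ≤ u ∧ (u : ℝ) ≤ gridPoint hT δ k + δ := by
  have hu : 0 ≤ (u : ℝ) / δ := div_nonneg u.2.1 hδ.le
  have h1 : (⌊(u : ℝ) / δ⌋₊ : ℝ) * δ ≤ u := by
    rw [← le_div_iff₀ hδ]
    exact Nat.floor_le hu
  have h2 : (u : ℝ) < (⌊(u : ℝ) / δ⌋₊ + 1 : ℝ) * δ := by
    rw [← div_lt_iff₀ hδ]
    exact Nat.lt_floor_add_one _
  have h3 : (gridPoint hT δ ⌊(u : ℝ) / δ⌋₊ : ℝ) = (⌊(u : ℝ) / δ⌋₊ : ℝ) * δ := by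
    rw [gridPoint, projIcc_of_mem hT ⟨by positivity, h1.trans u.2.2⟩]
  refine ⟨⌊(u : ℝ) / δ⌋₊, ?_, ?_, ?_⟩
  · rw [Finset.mem_range, Nat.lt_succ_iff]
    exact Nat.floor_le_floor (div_le_div_of_nonneg_right u.2.2 hδ.le)
  · rw [← Subtype.coe_le_coe, h3]
    exact h1
  · rw [h3]
    linarith

/-- A bound, for fixed `n`, on the probability that the empirical graphon and the reference graphon
are not uniformly close. -/
lemma measure_edist_gt_le (hT : 0 ≤ T) (hH : H.IsContinuous) (hord : 𝒢.OrderedLabels) {δ η : ℝ}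
    (hδ : 0 < δ) (hη : 0 < η) (hη1 : η ≤ 1) (hn : 1 ≤ η * n) :
    P {ω | ENNReal.ofReal (8 * η) < edist (𝒢.h ω) (hH.cutPath (𝒢.F ω))} ≤
      ∑ k ∈ Finset.range (⌊T / δ⌋₊ + 1), ((1 + ENNReal.ofReal η⁻¹) *
        P {ω | 𝒢.C (gridPoint hT δ k) δ ω > η * ((n : ℕ).choose 2 : ℝ)} +
        ENNReal.ofReal (2 * 4 ^ (n : ℕ) * Real.exp (-(η ^ 2 * (n : ℝ) ^ 2 / 16)))) := by
  classical
  have hn0 : (0 : ℝ) < n := by exact_mod_cast n.pos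
  obtain ⟨D₀, hD₀c, hD₀⟩ := TopologicalSpace.exists_countable_dense (TimeInterval T)
  -- The grid points include `T`, since they are truncated there.
  set D : Set (TimeInterval T) := D₀ ∪ range (gridPoint hT δ) with hD
  have hDc : D.Countable := hD₀c.union (countable_range _)
  have hDdense : Dense D := hD₀.mono subset_union_left
  have hDT : ∀ t : TimeInterval T, (t : ℝ) = T → t ∈ D := by
    intro t ht
    obtain ⟨k, hk⟩ := exists_nat_gt (T / δ)
    refine Or.inr ⟨k, Subtype.ext ?_⟩
    rw [gridPoint, projIcc_of_right_le hT ((div_lt_iff₀ hδ).1 hk).le, ht]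
  set B := fun k => 𝒢.changeSet D (gridPoint hT δ k) δ with hB
  have hBm : ∀ k e, MeasurableSet (B k e) := fun k e => 𝒢.measurableSet_changeSet hDc _ δ e
  set S₁ : ℕ → Set Ω := fun k => {ω | η * (edgePairs n).card <
    ∑ e ∈ edgePairs n, (B k e).indicator (fun _ => (1 : ℝ)) ω} with hS₁
  set S₂ : ℕ → Set Ω := fun k => {ω | 2 * η * (edgePairs n).card <
    ∑ e ∈ edgePairs n, (P[(B k e).indicator (fun _ => (1 : ℝ)) | 𝒢.typeSigma]) ω} with hS₂
  set S₃ : ℕ → Set Ω := fun k => {ω | ¬ CutNormLE (edgeDeviation (𝒢.prob (gridPoint hT δ k) ω)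
    (𝒢.G (gridPoint hT δ k) ω)) (η * (n : ℝ) ^ 2)} with hS₃
  have hprob : ∀ᵐ ω ∂P, ∀ u ∈ D, ∀ k, ∀ e ∈ edgePairs n, gridPoint hT δ k ≤ u →
      (u : ℝ) ≤ gridPoint hT δ k + δ →
      |𝒢.prob u ω e.1 e.2 - 𝒢.prob (gridPoint hT δ k) ω e.1 e.2| ≤
        (P[(B k e).indicator (fun _ => (1 : ℝ)) | 𝒢.typeSigma]) ω := by
    refine (ae_ball_iff hDc).2 fun u hu => ae_all_iff.2 fun k => ?_
    refine (ae_ball_iff (edgePairs n).countable_toSet).2 fun e he => ?_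
    by_cases h : gridPoint hT δ k ≤ u ∧ (u : ℝ) ≤ gridPoint hT δ k + δ
    · filter_upwards [𝒢.abs_prob_sub_prob_le (gridPoint hT δ k) u (fst_ne_snd_of_mem_edgePairs he)
        (hBm k e) fun ω hω => 𝒢.mem_changeSet_iff.2 ⟨u, hu, h.1, h.2, hω⟩] with ω hω _ _ using hω
    · exact ae_of_all _ fun ω h1 h2 => absurd ⟨h1, h2⟩ h
  have hsub : {ω | ENNReal.ofReal (8 * η) < edist (𝒢.h ω) (hH.cutPath (𝒢.F ω))} ≤ᵐ[P]
      ⋃ k ∈ Finset.range (⌊T / δ⌋₊ + 1), (S₁ k ∪ S₂ k ∪ S₃ k) := by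
    filter_upwards [hprob] with ω hω hlt
    by_contra hbad
    refine absurd hlt (not_lt.2 (SkorokhodSpace.edist_le_of_dense _ _ hDdense hDT fun u hu => ?_))
    obtain ⟨k, hk, hku, huk⟩ := exists_gridPoint hT hδ u
    have hbad' : ω ∉ S₁ k ∪ S₂ k ∪ S₃ k := fun h => hbad (mem_biUnion hk h)
    simp only [mem_union, not_or] at hbad'
    obtain ⟨⟨h1, h2⟩, h3⟩ := hbad'
    rw [edist_dist]
    refine ENNReal.ofReal_le_ofReal ((𝒢.dist_h_cutPath_le hH hord (gridPoint hT δ k) u ω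
      (not_not.1 h3) (N := η * (edgePairs n).card) ?_
      (M := 2 * η * (edgePairs n).card) ?_).trans ?_)
    · refine le_trans (Finset.sum_le_sum fun e _ => ?_) (not_lt.1 h1)
      by_cases he : (𝒢.G (gridPoint hT δ k) ω).Adj e.1 e.2 ↔ (𝒢.G u ω).Adj e.1 e.2
      · simp only [he, sub_self, abs_zero]
        exact indicator_nonneg (by simp) ω
      · rw [indicator_of_mem (𝒢.mem_changeSet_iff.2 ⟨u, hu, hku, huk, he⟩)]
        split_ifs <;> norm_num
    · exact le_trans (Finset.sum_le_sum fun e he => hω u hu k e he hku huk) (not_lt.1 h2)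
    · rw [div_le_iff₀ (by positivity)]
      have hK := card_edgePairs_le n
      nlinarith
  refine (measure_mono_ae hsub).trans ((measure_biUnion_finset_le _ _).trans ?_)
  refine Finset.sum_le_sum fun k _ => ?_
  have hS₁le : P (S₁ k) ≤
      P {ω | 𝒢.C (gridPoint hT δ k) δ ω > η * ((n : ℕ).choose 2 : ℝ)} := by
    refine measure_mono fun ω hω => ?_
    simp only [hS₁, mem_ofPred_eq, card_edgePairs] at hω
    exact hω.trans_le (𝒢.sum_indicator_changeSet_le_C D _ δ ω)
  calc P (S₁ k ∪ S₂ k ∪ S₃ k) ≤ P (S₁ k) + P (S₂ k) + P (S₃ k) :=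
        (measure_union_le _ _).trans (add_le_add_left (measure_union_le _ _) _)
    _ ≤ P (S₁ k) + ENNReal.ofReal η⁻¹ * P (S₁ k) + _ :=
        add_le_add (add_le_add le_rfl
          (measure_sum_condExp_gt_le 𝒢.typeSigma_le (edgePairs n) (B k) (hBm k) hη))
          (𝒢.measure_not_cutNormLE_le _ hη hη1)
    _ ≤ _ := by
        rw [← one_add_mul]
        gcongr

end GraphProcess

/-! ### Convergence of the graph-valued process -/

lemma tendsto_four_pow_mul_exp {c : ℝ} (hc : 0 < c) :
    Tendsto (fun n : ℕ+ => 2 * 4 ^ (n : ℕ) * Real.exp (-(c * (n : ℝ) ^ 2))) atTop (𝓝 0) := by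
  have h1 : Tendsto (fun n : ℕ+ => (n : ℝ)) atTop atTop :=
    tendsto_natCast_atTop_atTop.comp tendsto_PNat_val_atTop_atTop
  have h2 : Tendsto (fun x : ℝ => x * (Real.log 4 + -(c * x))) atTop atBot :=
    tendsto_id.atTop_mul_atBot₀
      (tendsto_atBot_add_const_left _ _ (tendsto_neg_atTop_atBot.comp
        (tendsto_id.const_mul_atTop hc)))
  have h3 := ((Real.tendsto_exp_atBot.comp (h2.comp h1)).const_mul 2)
  rw [mul_zero] at h3
  refine h3.congr fun n => ?_
  simp only [Function.comp_apply]
  rw [mul_assoc, ← Real.exp_log (show (0 : ℝ) < 4 by norm_num), ← Real.exp_nat_mul,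
    ← Real.exp_add, Real.exp_log (by norm_num)]
  ring_nf

/-- The empirical graphons and the reference graphons of the empirical type distributions are
uniformly close in probability. -/
lemma tendsto_measure_edist_h_cutPath {T : ℝ} (hT : 0 < T) {H : EdgeProbability T}
    {Ω : ℕ+ → Type*} [∀ n, MeasurableSpace (Ω n)] {P : ∀ n, Measure (Ω n)}
    [∀ n, IsProbabilityMeasure (P n)] {𝒢 : ∀ n, GraphProcess H n (P n)} (hH : H.IsContinuous)
    (hord : ∀ n, (𝒢 n).OrderedLabels) (hchange : UniformEdgeChange 𝒢) {ε : ℝ} (hε : 0 < ε) :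
    Tendsto (fun n => P n {ω | ENNReal.ofReal ε <
      edist ((𝒢 n).h ω) (hH.cutPath ((𝒢 n).F ω))}) atTop (𝓝 0) := by
  set η : ℝ := min 1 (ε / 8) with hη_def
  have hη : 0 < η := lt_min one_pos (by positivity)
  have hη1 : η ≤ 1 := min_le_left _ _
  have hηε : 8 * η ≤ ε := by linarith [min_le_right 1 (ε / 8)]
  rw [ENNReal.tendsto_nhds_zero]
  intro κ hκ
  set c : ℝ≥0∞ := 1 + ENNReal.ofReal η⁻¹ with hc
  have hctop : c ≠ ∞ := by simp [hc]
  have hc0 : c ≠ 0 := by simp [hc]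
  have hκ' : 0 < κ / 2 / (2 * c) :=
    ENNReal.div_pos (ENNReal.div_pos hκ.ne' (by simp)).ne' (ENNReal.mul_ne_top (by simp) hctop)
  -- The width `δ` of the grid is fixed before `n` tends to infinity.
  obtain ⟨δ, hδlim, hδ, hδT⟩ := (((hchange η hη).eventually_lt_const hκ').and
    (Ioc_mem_nhdsGT hT)).exists
  set m := ⌊T / δ⌋₊ with hm
  have hgrid : ((m + 1 : ℕ) : ℝ≥0∞) ≤ 2 * ENNReal.ofReal (T / δ) := by
    have h1 : (m : ℝ) ≤ T / δ := Nat.floor_le (by positivity)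
    have h2 : 1 ≤ T / δ := (one_le_div hδ).2 hδT
    rw [← ENNReal.ofReal_natCast, ← ENNReal.ofReal_ofNat 2, ← ENNReal.ofReal_mul zero_le_two]
    refine ENNReal.ofReal_le_ofReal ?_
    push_cast
    linarith
  have hconc : Tendsto (fun n : ℕ+ => ((m + 1 : ℕ) : ℝ≥0∞) *
      ENNReal.ofReal (2 * 4 ^ (n : ℕ) * Real.exp (-(η ^ 2 * (n : ℝ) ^ 2 / 16)))) atTop (𝓝 0) := by
    have h := ENNReal.Tendsto.const_mul (a := ((m + 1 : ℕ) : ℝ≥0∞))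
      (ENNReal.tendsto_ofReal (tendsto_four_pow_mul_exp (c := η ^ 2 / 16) (by positivity)))
      (.inr (ENNReal.natCast_ne_top _))
    rw [ENNReal.ofReal_zero, mul_zero] at h
    refine h.congr fun n => ?_
    congr 5
    ring
  have hlarge : ∀ᶠ n : ℕ+ in atTop, 1 ≤ η * n :=
    (((tendsto_natCast_atTop_atTop.comp tendsto_PNat_val_atTop_atTop).const_mul_atTop
      hη).eventually_ge_atTop 1)
  filter_upwards [eventually_lt_of_limsup_lt hδlim, hlarge,
    (ENNReal.tendsto_nhds_zero.1 hconc) (κ / 2) (ENNReal.div_pos hκ.ne' (by simp))]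
    with n hn1 hn2 hn3
  rw [← ENNReal.mul_iSup] at hn1
  set q : ℝ≥0∞ := ⨆ t : TimeInterval T, P n {ω | (𝒢 n).C t δ ω > η * ((n : ℕ).choose 2 : ℝ)}
  calc P n {ω | ENNReal.ofReal ε < edist ((𝒢 n).h ω) (hH.cutPath ((𝒢 n).F ω))}
      ≤ P n {ω | ENNReal.ofReal (8 * η) < edist ((𝒢 n).h ω) (hH.cutPath ((𝒢 n).F ω))} :=
        measure_mono fun ω hω => (ENNReal.ofReal_le_ofReal hηε).trans_lt hω
    _ ≤ _ := (𝒢 n).measure_edist_gt_le hT.le hH (hord n) hδ hη hη1 hn2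
    _ ≤ ∑ _k ∈ Finset.range (m + 1), (c * q +
          ENNReal.ofReal (2 * 4 ^ (n : ℕ) * Real.exp (-(η ^ 2 * (n : ℝ) ^ 2 / 16)))) := by
        refine Finset.sum_le_sum fun k _ => add_le_add_left (mul_le_mul_right ?_ c) _
        exact le_iSup (fun t : TimeInterval T =>
          P n {ω | (𝒢 n).C t δ ω > η * ((n : ℕ).choose 2 : ℝ)}) _
    _ = ((m + 1 : ℕ) : ℝ≥0∞) * (c * q) + ((m + 1 : ℕ) : ℝ≥0∞) *
          ENNReal.ofReal (2 * 4 ^ (n : ℕ) * Real.exp (-(η ^ 2 * (n : ℝ) ^ 2 / 16))) := by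
        rw [Finset.sum_const, Finset.card_range, nsmul_eq_mul, mul_add]
    _ ≤ κ / 2 + κ / 2 := by
        refine add_le_add ?_ hn3
        calc ((m + 1 : ℕ) : ℝ≥0∞) * (c * q) ≤ 2 * ENNReal.ofReal (T / δ) * (c * q) := by gcongr
          _ = 2 * c * (ENNReal.ofReal (T / δ) * q) := by ring
          _ ≤ 2 * c * (κ / 2 / (2 * c)) := by gcongr
          _ ≤ κ / 2 := ENNReal.mul_div_le
    _ = κ := ENNReal.add_halves κ

theorem mainTheorem3 {T : ℝ} (hT : 0 < T) (H : EdgeProbability T)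
    {Ω : ℕ+ → Type*} [∀ n, MeasurableSpace (Ω n)] (P : ∀ n, Measure (Ω n))
    [∀ n, IsProbabilityMeasure (P n)] (𝒢 : ∀ n, GraphProcess H n (P n))
    {Ω' : Type*} [MeasurableSpace Ω'] (P' : Measure Ω') [IsProbabilityMeasure P']
    (F : Ω' → TypePath T)
    (hCP : H.IsContinuous)
    (hCD : TendstoInDistribution (fun n => (𝒢 n).F) atTop F P P')
    (hVL : ∀ n, (𝒢 n).OrderedLabels)
    (hFLT : UniformEdgeChange 𝒢) :
    TendstoInDistribution (fun n => (𝒢 n).h) atTop (fun ω => hCP.cutPath (F ω)) P P' := by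
  have hX := hCD.continuous_comp (g := hCP.cutPath) hCP.continuous_cutPath
  exact tendstoInDistribution_of_tendsto_measure_edist hX (fun n => (𝒢 n).aemeasurable_h)
    fun _ hε => tendsto_measure_edist_h_cutPath hT hCP hVL hFLT hε
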